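/- **Setting.** Let $\mathrm{Vars}$ be a finite set and $\mathrm{Store}=\mathrm{Vars}\to\mathbb N$. A plain transition is a pair $(\sigma,\sigma')$ of stores; a return transition is a pair $(\sigma,\sigma'\,\mathrm{Ret})$; $\tau$ stands for $\sigma'$ or $\sigma'\,\mathrm{Ret}$. $\mathrm{TSeq}$ is the set of finite sequences of transitions, at most one of which is a return transition, optionally followed by a marker $\mathrm{Done}$ if there is a return transition. $\mathrm{PSeq}$ is the set of finite sequences of plain transitions, optionally followed by $\mathrm{Done}$; its elements other than $\mathrm{Done}$ are called proper. Both sets are ordered by the prefix relation. $\mathrm{Proc}$ (resp. $\mathrm{AProc}$) is the set of non-empty prefix-closed sets of elements of $\mathrm{TSeq}$ (resp. of proper elements of $\mathrm{PSeq}$), ordered by inclusion; both are $\omega$-cpos, i.e. posets with sups of increasing sequences. For $u\in\mathrm{PSeq}$ and $v$ in $\mathrm{PSeq}$ or $\mathrm{TSeq}$, $u\bowtie v$ is the set of shuffles of $u$ and $v$, where a shuffle ends in $\mathrm{Done}$ iff both $u$ and $v$ do; $P\bowtie P'=\bigcup_{u\in P,v\in P'}u\bowtie v$ for $P,P'\in\mathrm{AProc}$.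 For $v\in\mathrm{TSeq}$ put $u\rhd\varepsilon=\{\varepsilon\}$, $u\rhd(\sigma,\tau)v=\{(\sigma,\tau)w\mid w\in u\bowtie v\}$, and $\varepsilon\lhd v=\{\varepsilon\}$, $(\sigma,\sigma')u\lhd v=\{(\sigma,\sigma')w\mid w\in u\bowtie v\}$. For $P,Q\in\mathrm{Proc}$, $$P\circ Q=\{u(\sigma,\tau)v\mid\exists\sigma',w,w'.\ u(\sigma,\sigma'\,\mathrm{Ret})w\in P,\ (\sigma',\tau)w'\in Q,\ v\in w\bowtie w'\}\cup\{u\in P\mid u\text{ has no return transition}\}.$$ On $\mathrm{AProc}$ put $\mathrm{update}_{l,n}(P)=\{(\sigma,\sigma')u\mid(\sigma[l\mapsto n],\sigma')u\in P\}\cup\{\varepsilon\}$, $\mathrm{lookup}_l((P_n)_n)=\bigcup_n\{(\sigma,\sigma')u\in P_n\mid\sigma(l)=n\}\cup\{\varepsilon\}$, $\Omega=\{\varepsilon\}$, $\mathrm d(P)=\{(\sigma,\sigma)u\mid u\in P\}\cup\{\varepsilon\}$, $\mathrm{halt}=\{(\sigma,\sigma)\mathrm{Done}\mid\sigma\in\mathrm{Store}\}\!\downarrow$,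 with $\cup$ the union. **The theory $L_{\mathrm{Proc}}$.** A model is an $\omega$-cpo $A$ with operations $\mathrm{update}_{l,n}:A\to A$, $\mathrm{lookup}_l:A^{\mathbb N}\to A$ ($l\in\mathrm{Vars}$, $n\in\mathbb N$), $\cup:A^2\to A$, $\Omega\in A$, $\mathrm d:A\to A$, $\mathrm{async}=\rhd$ and $\mathrm{yield\_to}=\lhd:\mathrm{AProc}\times A\to A$, all $\omega$-continuous (jointly in their arguments), such that, with $P\bowtie x:=(P\rhd x)\cup(P\lhd x)$: * (stores) $\mathrm{lookup}_l((\mathrm{update}_{l,n}(x))_n)=x$; $\mathrm{lookup}_l((\mathrm{lookup}_l((x_{mn})_n))_m)=\mathrm{lookup}_l((x_{nn})_n)$; $\mathrm{update}_{l,m}(\mathrm{update}_{l,n}(x))=\mathrm{update}_{l,n}(x)$; $\mathrm{update}_{l,n}(\mathrm{lookup}_l((x_m)_m))=\mathrm{update}_{l,n}(x_n)$; and for $l\ne k$ each of $\mathrm{lookup}_l,\mathrm{update}_{l,m}$ commutes with each of $\mathrm{lookup}_k,\mathrm{update}_{k,n}$; * (choice, nontermination) $\cup$ is associative, commutative and idempotent,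 $x\le x\cup y$, $\Omega\le x$; * $\mathrm{update}_{l,n}$ and $\mathrm{lookup}_l$ commute with $\Omega$ and with $\cup$, and $\mathrm d(x\cup y)=\mathrm d(x)\cup\mathrm d(y)$; * $\rhd$ and $\lhd$ preserve $\cup$ in each of their two arguments; * $P\rhd-$ commutes with $\mathrm{update}_{l,n}$, $\mathrm{lookup}_l$, $\Omega$; $P\rhd\mathrm d(x)=\mathrm d(P\bowtie x)$; $P\rhd(P'\rhd x)=(P\bowtie P')\rhd x$; * $-\lhd x$ preserves $\mathrm{update}_{l,n}$, $\mathrm{lookup}_l$, $\Omega$ (those of $\mathrm{AProc}$ on the left); $\mathrm d(P)\lhd x=\mathrm d(P\bowtie x)$; $\mathrm{halt}\lhd x=\mathrm d(x)$; * $\Omega_{\mathrm{AProc}}\rhd x\le x$. A morphism of models is an $\omega$-continuous map that preserves all the operations. **The model of ideals.** Let $Q=\{\mathrm{Ret}\}$ and let $Q\text{-}\mathrm{Trans}$ be the set of non-empty sequences of plain transitions, the last of which may instead be a marked transition $(\sigma,\sigma'\,(\mathrm{Ret},v))$ with $v\in\mathrm{PSeq}$, ordered by the least preorder that contains the prefix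 relation and has $u(\sigma,\sigma'(\mathrm{Ret},v))\le u(\sigma,\sigma'(\mathrm{Ret},v'))$ for $v$ a prefix of $v'$. Let $\mathcal I_\omega(Q\text{-}\mathrm{Trans})$ be the set of its denumerably generated downwards-closed subsets, ordered by inclusion; $X\!\downarrow$ is the downward closure of $X$. Here $\tau$ is a store or a store marked with some $(\mathrm{Ret},v)$, and $u^-$ is $u$ less any $\mathrm{Done}$. Put $\mathrm{update}_{l,n}(I)=\{(\sigma,\tau)u\mid(\sigma[l\mapsto n],\tau)u\in I\}$, $\mathrm{lookup}_l((I_n)_n)=\bigcup_n\{(\sigma,\tau)u\in I_n\mid\sigma(l)=n\}$, $I\cup J$ the union, $\Omega=\emptyset$, $\mathrm d(I)=\{(\sigma,\sigma)u\mid u\in I\}\cup\{(\sigma,\sigma)\mid \sigma\in\mathrm{Store}\}$, $P\rhd I=\bigcup_{u\in P,v\in I}u\rhd v$ and $P\lhd I=\bigcup_{u\in P,v\in I}u\lhd v\cup\{u^-\mid u\in P,u\neq\varepsilon\}$, where for $u$ in $\mathrm{PSeq}$ proper and $v\in Q\text{-}\mathrm{Trans}$ one defines by mutual recursion, with $u\bowtie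 v=(u\lhd v)\cup(u\rhd v)$: $u\rhd(\sigma,\sigma')=\{(\sigma,\sigma')u^-\}\!\downarrow$; $u\rhd(\sigma,\sigma'(\mathrm{Ret},u'))=\{(\sigma,\sigma'(\mathrm{Ret},w))\mid w\in u\bowtie u'\}\!\downarrow$; $u\rhd(\sigma,\sigma')v=\{(\sigma,\sigma')w\mid w\in u\bowtie v\}\!\downarrow$; $\varepsilon\lhd v=\emptyset$; $(\sigma,\sigma')\mathrm{Done}\lhd v=\{(\sigma,\sigma')v\}\!\downarrow$; $(\sigma,\sigma')u\lhd v=\{(\sigma,\sigma')w\mid w\in u\bowtie v\}\!\downarrow$ for $u$ proper. Let $\theta:Q\text{-}\mathrm{Trans}\to\mathrm{TSeq}$ fix the plain sequences and send $u(\sigma,\sigma'(\mathrm{Ret},v))$ to $u(\sigma,\sigma'\,\mathrm{Ret})v$, and let $\tilde\theta(I)=\theta(I)\cup\{\varepsilon\}$. **Corollary 6.5.** Equip $\mathrm{Proc}$ with the operations $$\begin{array}{rcl} \mathrm{update}_{x,n}(P)&=&\{(\sigma,\tau)u\mid(\sigma[x\mapsto n],\tau)u\in P\}\cup\{\varepsilon\}\\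 \mathrm{lookup}_x((P_n)_n)&=&\bigcup_n\{(\sigma,\tau)u\in P_n\mid\sigma(x)=n\}\cup\{\varepsilon\}\\ P\cup_{\mathrm{Proc}}Q&=&P\cup Q\\ \Omega&=&\{\varepsilon\}\\ \mathrm d(P)&=&\{(\sigma,\sigma)u\mid\sigma\in\mathrm{Store},u\in P\}\cup\{\varepsilon\}\\ P\rhd Q&=&\bigcup_{u\in P,v\in Q}u\rhd v\\ P\lhd Q&=&\bigcup_{u\in P,v\in Q}u\lhd v. \end{array}$$ Then: 1. $\mathcal I_\omega(\{\mathrm{Ret}\}\text{-}\mathrm{Trans})$ and $\mathrm{Proc}$ are models of $L_{\mathrm{Proc}}$, and $\tilde\theta:\mathcal I_\omega(\{\mathrm{Ret}\}\text{-}\mathrm{Trans})\to\mathrm{Proc}$ is an isomorphism of $L_{\mathrm{Proc}}$-models. 2. $\mathrm{Proc}$ is the free model of $L_{\mathrm{Proc}}$ over the one-point $\omega$-cpo $\{\mathrm{Ret}\}$, with unit $\eta(\mathrm{Ret})=[\![\mathtt{skip}]\!]=\{(\sigma,\sigma\,\mathrm{Ret})\mathrm{Done}\mid\sigma\in\mathrm{Store}\}\!\downarrow$: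 for every model $A$ and every map $f:\{\mathrm{Ret}\}\to A$ there is exactly one morphism of models $h:\mathrm{Proc}\to A$ with $h(\eta(\mathrm{Ret}))=f(\mathrm{Ret})$. 3. For every $f:\{\mathrm{Ret}\}\to\mathrm{Proc}$, its Kleisli extension $f^\dagger$, i.e. the unique morphism of models $\mathrm{Proc}\to\mathrm{Proc}$ with $f^\dagger(\eta(\mathrm{Ret}))=f(\mathrm{Ret})$, is $f^\dagger(P)=P\circ f(\mathrm{Ret})$. -/

import Mathlib

open OmegaCompletePartialOrder

noncomputable section

namespace CoopThreads

/-! ## Stores and sequences -/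

/-- Stores over a set `V` of variables, with natural numbers as values. -/
abbrev Store (V : Type*) := V → ℕ

/-- Pure transition sequences: finite sequences of plain transitions `(s, t)`, possibly followed by
the marker `Done`. The constructors are the empty sequence, the sequence `Done`, and `(s, t) u`. -/
inductive PSeq (V : Type*) where
  | nil : PSeq V
  | done : PSeq V
  | step (s t : Store V) (u : PSeq V) : PSeq V

/-- (Main-thread) transition sequences: finite sequences of transitions, at most one of which is a
return transition `(s, t Ret)`, and which may end in the marker `Done` provided that there is a
return transition. The constructors are the empty sequence, `(s, t) u` and `(s, t Ret) u`;
what follows the return transition is exactly a pure transition sequence. -/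
inductive TSeq (V : Type*) where
  | nil : TSeq V
  | step (s t : Store V) (u : TSeq V) : TSeq V
  | ret (s t : Store V) (u : PSeq V) : TSeq V

/-- Basic `R`-transition sequences: non-empty sequences of plain transitions, of which the
last one may instead be an `R`-transition `(s, t x)`, marked with `x : R`. -/
inductive BTrans (V : Type*) (R : Type*) where
  | last (s t : Store V) : BTrans V R
  | lastRet (s t : Store V) (x : R) : BTrans V R
  | step (s t : Store V) (u : BTrans V R) : BTrans V R

/-- The prefix relation on pure transition sequences. -/
inductive PSeq.Pfx {V : Type*} : PSeq V → PSeq V → Prop where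
  | nil (u : PSeq V) : PSeq.Pfx .nil u
  | done : PSeq.Pfx .done .done
  | step (s t : Store V) {u v : PSeq V} (h : PSeq.Pfx u v) : PSeq.Pfx (.step s t u) (.step s t v)

instance PSeq.instPartialOrder {V : Type*} : PartialOrder (PSeq V) where
  le := PSeq.Pfx
  le_refl u := by
    induction u with
    | nil => exact .nil _
    | done => exact .done
    | step s t u ih => exact .step s t ih
  le_trans u v w h k := by
    induction h generalizing w with
    | nil u => exact .nil _
    | done => exact k
    | step s t h ih => cases k with | step _ _ k => exact .step s t (ih _ k)
  le_antisymm u v h k := by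
    induction h with
    | nil u => cases k; rfl
    | done => rfl
    | step s t h ih => cases k with | step _ _ k => rw [ih k]

/-- The prefix relation on transition sequences. -/
inductive TSeq.Pfx {V : Type*} : TSeq V → TSeq V → Prop where
  | nil (u : TSeq V) : TSeq.Pfx .nil u
  | step (s t : Store V) {u v : TSeq V} (h : TSeq.Pfx u v) : TSeq.Pfx (.step s t u) (.step s t v)
  | ret (s t : Store V) {u v : PSeq V} (h : u ≤ v) : TSeq.Pfx (.ret s t u) (.ret s t v)

instance TSeq.instPartialOrder {V : Type*} : PartialOrder (TSeq V) where
  le := TSeq.Pfx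
  le_refl u := by
    induction u with
    | nil => exact .nil _
    | step s t u ih => exact .step s t ih
    | ret s t u => exact .ret s t le_rfl
  le_trans u v w h k := by
    induction h generalizing w with
    | nil u => exact .nil _
    | step s t h ih => cases k with | step _ _ k => exact .step s t (ih _ k)
    | ret s t h => cases k with | ret _ _ k => exact .ret s t (h.trans k)
  le_antisymm u v h k := by
    induction h with
    | nil u => cases k; rfl
    | step s t h ih => cases k with | step _ _ k => rw [ih k]
    | ret s t h => cases k with | ret _ _ k => rw [le_antisymm h k]

/-- The order on basic `R`-transition sequences, the least preorder that contains the prefix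
relation and is such that `u (s, t x) ≤ u (s, t y)` whenever `x ≤ y`. -/
inductive BTrans.Le {V R : Type*} [LE R] : BTrans V R → BTrans V R → Prop where
  | last (s t : Store V) : BTrans.Le (.last s t) (.last s t)
  | last_step (s t : Store V) (u : BTrans V R) : BTrans.Le (.last s t) (.step s t u)
  | lastRet (s t : Store V) {x y : R} (h : x ≤ y) : BTrans.Le (.lastRet s t x) (.lastRet s t y)
  | step (s t : Store V) {u v : BTrans V R} (h : BTrans.Le u v) :
      BTrans.Le (.step s t u) (.step s t v)

instance BTrans.instPartialOrder {V R : Type*} [PartialOrder R] : PartialOrder (BTrans V R) where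
  le := BTrans.Le
  le_refl u := by
    induction u with
    | last s t => exact .last s t
    | lastRet s t x => exact .lastRet s t le_rfl
    | step s t u ih => exact .step s t ih
  le_trans u v w h k := by
    induction h generalizing w with
    | last s t => exact k
    | last_step s t u => cases k with | step _ _ k => exact .last_step s t _
    | lastRet s t h => cases k with | lastRet _ _ k => exact .lastRet s t (h.trans k)
    | step s t h ih => cases k with | step _ _ k => exact .step s t (ih _ k)
  le_antisymm u v h k := by
    induction h with
    | last s t => rfl
    | last_step s t u => cases k
    | lastRet s t h => cases k with | lastRet _ _ k => rw [le_antisymm h k]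
    | step s t h ih => cases k with | step _ _ k => rw [ih k]

/-- `Q`-transition sequences: basic `(Q × PSeq)`-transition sequences. -/
abbrev QTrans (V Q : Type*) := BTrans V (Q × PSeq V)

/-- The one-point set `{Ret}`. -/
inductive RetPoint where
  | Ret : RetPoint

instance RetPoint.instOmegaCompletePartialOrder : OmegaCompletePartialOrder RetPoint where
  le _ _ := True
  le_refl _ := trivial
  le_trans _ _ _ _ _ := trivial
  le_antisymm a b _ _ := by cases a; cases b; rfl
  ωSup _ := .Ret
  le_ωSup _ _ := trivial
  ωSup_le _ _ _ := trivial

instance RetPoint.instCountable : Countable RetPoint :=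
  ⟨⟨fun _ => 0, fun a b _ => by cases a; cases b; rfl⟩⟩

instance PSeq.instCountable {V : Type*} [Finite V] : Countable (PSeq V) := by
  let f : List (Store V × Store V) × Bool → PSeq V := fun p =>
    p.1.foldr (fun a u => .step a.1 a.2 u) (bif p.2 then .done else .nil)
  have hf : Function.Surjective f := by
    intro u
    induction u with
    | nil => exact ⟨([], false), rfl⟩
    | done => exact ⟨([], true), rfl⟩
    | step s t u ih =>
      obtain ⟨⟨l, b⟩, rfl⟩ := ih
      exact ⟨((s, t) :: l, b), rfl⟩
  exact hf.countable

instance BTrans.instCountable {V R : Type*} [Finite V] [Countable R] :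
    Countable (BTrans V R) := by
  let f : List (Store V × Store V) × (Store V × Store V × Option R) → BTrans V R := fun p =>
    p.1.foldr (fun a u => .step a.1 a.2 u)
      (match p.2 with
        | (s, t, none) => .last s t
        | (s, t, some x) => .lastRet s t x)
  have hf : Function.Surjective f := by
    intro u
    induction u with
    | last s t => exact ⟨([], s, t, none), rfl⟩
    | lastRet s t x => exact ⟨([], s, t, some x), rfl⟩
    | step s t u ih =>
      obtain ⟨⟨l, b⟩, rfl⟩ := ih
      exact ⟨((s, t) :: l, b), rfl⟩
  exact hf.countable

/-! ## Shuffles -/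

/-- `PShuf u v w`: the pure transition sequence `w` is a shuffle of `u` and `v`. It ends in `Done`
exactly when both `u` and `v` do. -/
inductive PShuf {V : Type*} : PSeq V → PSeq V → PSeq V → Prop where
  | nil_nil : PShuf .nil .nil .nil
  | nil_done : PShuf .nil .done .nil
  | done_nil : PShuf .done .nil .nil
  | done_done : PShuf .done .done .done
  | left (s t : Store V) {u v w : PSeq V} (h : PShuf u v w) : PShuf (.step s t u) v (.step s t w)
  | right (s t : Store V) {u v w : PSeq V} (h : PShuf u v w) : PShuf u (.step s t v) (.step s t w)

/-- `TShuf u v w`: the transition sequence `w` is a shuffle of the pure transition sequence `u`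
and the transition sequence `v`. It ends in `Done` exactly when both `u` and `v` do. -/
inductive TShuf {V : Type*} : PSeq V → TSeq V → TSeq V → Prop where
  | nil_nil : TShuf .nil .nil .nil
  | done_nil : TShuf .done .nil .nil
  | left (s t : Store V) {u : PSeq V} {v w : TSeq V} (h : TShuf u v w) :
      TShuf (.step s t u) v (.step s t w)
  | right (s t : Store V) {u : PSeq V} {v w : TSeq V} (h : TShuf u v w) :
      TShuf u (.step s t v) (.step s t w)
  | left_ret (s t : Store V) {u v w : PSeq V} (h : PShuf u v w) :
      TShuf u (.ret s t v) (.ret s t w)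

theorem PShuf.of_le {V : Type*} {u v w w' : PSeq V} (h : PShuf u v w) (hw : w' ≤ w) :
    ∃ u' ≤ u, ∃ v' ≤ v, PShuf u' v' w' := by
  induction h generalizing w' with
  | nil_nil => cases hw; exact ⟨_, le_rfl, _, le_rfl, .nil_nil⟩
  | nil_done => cases hw; exact ⟨_, le_rfl, _, le_rfl, .nil_done⟩
  | done_nil => cases hw; exact ⟨_, le_rfl, _, le_rfl, .done_nil⟩
  | done_done =>
    cases hw
    · exact ⟨_, .nil _, _, .nil _, .nil_nil⟩
    · exact ⟨_, le_rfl, _, le_rfl, .done_done⟩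
  | left s t h ih =>
    cases hw with
    | nil => exact ⟨_, .nil _, _, .nil _, .nil_nil⟩
    | step _ _ k =>
      obtain ⟨u', hu, v', hv, h'⟩ := ih k
      exact ⟨_, .step s t hu, _, hv, .left s t h'⟩
  | right s t h ih =>
    cases hw with
    | nil => exact ⟨_, .nil _, _, .nil _, .nil_nil⟩
    | step _ _ k =>
      obtain ⟨u', hu, v', hv, h'⟩ := ih k
      exact ⟨_, hu, _, .step s t hv, .right s t h'⟩

theorem TShuf.of_le {V : Type*} {u : PSeq V} {v w w' : TSeq V} (h : TShuf u v w) (hw : w' ≤ w) :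
    ∃ u' ≤ u, ∃ v' ≤ v, TShuf u' v' w' := by
  induction h generalizing w' with
  | nil_nil => cases hw; exact ⟨_, le_rfl, _, le_rfl, .nil_nil⟩
  | done_nil => cases hw; exact ⟨_, le_rfl, _, le_rfl, .done_nil⟩
  | left s t h ih =>
    cases hw with
    | nil => exact ⟨_, .nil _, _, .nil _, .nil_nil⟩
    | step _ _ k =>
      obtain ⟨u', hu, v', hv, h'⟩ := ih k
      exact ⟨_, .step s t hu, _, hv, .left s t h'⟩
  | right s t h ih =>
    cases hw with
    | nil => exact ⟨_, .nil _, _, .nil _, .nil_nil⟩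
    | step _ _ k =>
      obtain ⟨u', hu, v', hv, h'⟩ := ih k
      exact ⟨_, hu, _, .step s t hv, .right s t h'⟩
  | left_ret s t h =>
    cases hw with
    | nil => exact ⟨_, .nil _, _, .nil _, .nil_nil⟩
    | ret _ _ k =>
      obtain ⟨u', hu, v', hv, h'⟩ := h.of_le k
      exact ⟨_, hu, _, .ret s t hv, .left_ret s t h'⟩

/-- The right shuffles `u ▷ v` of a pure transition sequence with a transition sequence:
`u ▷ ε = {ε}` and `u ▷ (s, τ) v = {(s, τ) w | w a shuffle of u and v}`. -/
def rightShuffle {V : Type*} (u : PSeq V) : TSeq V → Set (TSeq V)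
  | .nil => {.nil}
  | .step s t v => {r | ∃ w, TShuf u v w ∧ r = .step s t w}
  | .ret s t v => {r | ∃ w, PShuf u v w ∧ r = .ret s t w}

/-- The left shuffles `u ◁ v` of a pure transition sequence with a transition sequence:
`ε ◁ v = {ε}` and `(s, t) u ◁ v = {(s, t) w | w a shuffle of u and v}`. (The value at the
improper sequence `u = Done`, which is not a member of any asynchronous process, is never used.) -/
def leftShuffle {V : Type*} : PSeq V → TSeq V → Set (TSeq V)
  | .nil, _ => {.nil}
  | .done, _ => ∅
  | .step s t u, v => {r | ∃ w, TShuf u v w ∧ r = .step s t w}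

/-! ## Processes and asynchronous processes -/

/-- Processes: non-empty prefix-closed sets of transition sequences. -/
@[ext]
structure Proc (V : Type*) where
  carrier : Set (TSeq V)
  nonempty : carrier.Nonempty
  prefixClosed : ∀ ⦃u v : TSeq V⦄, u ≤ v → v ∈ carrier → u ∈ carrier

/-- Asynchronous processes: non-empty prefix-closed sets of proper pure transition sequences,
that is, of pure transition sequences other than `Done`. -/
@[ext]
structure AProc (V : Type*) where
  carrier : Set (PSeq V)
  nonempty : carrier.Nonempty
  prefixClosed : ∀ ⦃u v : PSeq V⦄, u ≤ v → v ∈ carrier → u ∈ carrier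
  proper : PSeq.done ∉ carrier

/-- `Iomega P` is the set of the denumerably generated ideals of the poset `P`, an ideal being a
downwards-closed subset. -/
@[ext]
structure Iomega (P : Type*) [PartialOrder P] where
  carrier : Set P
  lower : IsLowerSet carrier
  generated : ∃ X : Set P, X ⊆ carrier ∧ X.Countable ∧ ∀ u ∈ carrier, ∃ v ∈ X, u ≤ v

/-- The subset order, with unions as sups of increasing sequences. -/
instance Proc.instOmegaCompletePartialOrder {V : Type*} : OmegaCompletePartialOrder (Proc V) where
  toPartialOrder := PartialOrder.lift Proc.carrier fun _ _ h => Proc.ext h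
  ωSup c :=
    { carrier := ⋃ i, (c i).carrier
      nonempty := by
        obtain ⟨u, hu⟩ := (c 0).nonempty
        exact ⟨u, Set.mem_iUnion.2 ⟨0, hu⟩⟩
      prefixClosed := by
        intro u v h hv
        obtain ⟨i, hi⟩ := Set.mem_iUnion.1 hv
        exact Set.mem_iUnion.2 ⟨i, (c i).prefixClosed h hi⟩ }
  le_ωSup c i := Set.subset_iUnion (fun i => (c i).carrier) i
  ωSup_le _ _ h := Set.iUnion_subset h

/-- The subset order, with unions as sups of increasing sequences. -/
instance AProc.instOmegaCompletePartialOrder {V : Type*} :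
    OmegaCompletePartialOrder (AProc V) where
  toPartialOrder := PartialOrder.lift AProc.carrier fun _ _ h => AProc.ext h
  ωSup c :=
    { carrier := ⋃ i, (c i).carrier
      nonempty := by
        obtain ⟨u, hu⟩ := (c 0).nonempty
        exact ⟨u, Set.mem_iUnion.2 ⟨0, hu⟩⟩
      prefixClosed := by
        intro u v h hv
        obtain ⟨i, hi⟩ := Set.mem_iUnion.1 hv
        exact Set.mem_iUnion.2 ⟨i, (c i).prefixClosed h hi⟩
      proper := by
        intro h
        obtain ⟨i, hi⟩ := Set.mem_iUnion.1 h
        exact (c i).proper hi }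
  le_ωSup c i := Set.subset_iUnion (fun i => (c i).carrier) i
  ωSup_le _ _ h := Set.iUnion_subset h

/-- The subset order, with unions as sups of increasing sequences. -/
instance Iomega.instOmegaCompletePartialOrder {P : Type*} [PartialOrder P] :
    OmegaCompletePartialOrder (Iomega P) where
  toPartialOrder := PartialOrder.lift Iomega.carrier fun _ _ h => Iomega.ext h
  ωSup c :=
    { carrier := ⋃ i, (c i).carrier
      lower := isLowerSet_iUnion fun i => (c i).lower
      generated := by
        choose X hX hc hg using fun i => (c i).generated
        refine ⟨⋃ i, X i, Set.iUnion_mono hX, Set.countable_iUnion hc, ?_⟩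
        intro u hu
        obtain ⟨i, hi⟩ := Set.mem_iUnion.1 hu
        obtain ⟨v, hv, huv⟩ := hg i u hi
        exact ⟨v, Set.mem_iUnion.2 ⟨i, hv⟩, huv⟩ }
  le_ωSup c i := Set.subset_iUnion (fun i => (c i).carrier) i
  ωSup_le _ _ h := Set.iUnion_subset h

theorem Proc.nil_mem {V : Type*} (P : Proc V) : TSeq.nil ∈ P.carrier :=
  P.prefixClosed (.nil _) P.nonempty.some_mem

theorem AProc.nil_mem {V : Type*} (P : AProc V) : PSeq.nil ∈ P.carrier :=
  P.prefixClosed (.nil _) P.nonempty.some_mem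

/-- In a countable poset, every ideal is denumerably generated. -/
def Iomega.ofLower {P : Type*} [PartialOrder P] [Countable P] (s : Set P) (h : IsLowerSet s) :
    Iomega P where
  carrier := s
  lower := h
  generated := ⟨s, subset_rfl, s.to_countable, fun u hu => ⟨u, hu, le_rfl⟩⟩

/-! ## Operations on asynchronous processes -/

namespace AProc

variable {V : Type*}

/-- `{(s, t) u | (s[l ↦ n], t) u ∈ P} ∪ {ε}`. -/
def update [DecidableEq V] (l : V) (n : ℕ) (P : AProc V) : AProc V where
  carrier := {r | r = .nil ∨
    ∃ s t u, PSeq.step (Function.update s l n) t u ∈ P.carrier ∧ r = .step s t u}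
  nonempty := ⟨.nil, .inl rfl⟩
  prefixClosed := by
    rintro u v h (rfl | ⟨s, t, v, hv, rfl⟩)
    · cases h; exact .inl rfl
    · cases h with
      | nil => exact .inl rfl
      | step _ _ h => exact .inr ⟨s, t, _, P.prefixClosed (.step _ _ h) hv, rfl⟩
  proper := by rintro (h | ⟨s, t, v, hv, h⟩) <;> cases h

/-- `⋃ n, {(s, t) u ∈ P n | s l = n} ∪ {ε}`. -/
def lookup (l : V) (P : ℕ → AProc V) : AProc V where
  carrier := {r | r = .nil ∨
    ∃ n s t u, PSeq.step s t u ∈ (P n).carrier ∧ s l = n ∧ r = .step s t u}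
  nonempty := ⟨.nil, .inl rfl⟩
  prefixClosed := by
    rintro u v h (rfl | ⟨n, s, t, v, hv, hn, rfl⟩)
    · cases h; exact .inl rfl
    · cases h with
      | nil => exact .inl rfl
      | step _ _ h => exact .inr ⟨n, s, t, _, (P n).prefixClosed (.step _ _ h) hv, hn, rfl⟩
  proper := by rintro (h | ⟨n, s, t, v, hv, hn, h⟩) <;> cases h

/-- Binary choice `P ∪ Q`. -/
def union (P Q : AProc V) : AProc V where
  carrier := P.carrier ∪ Q.carrier
  nonempty := P.nonempty.inl
  prefixClosed := by
    rintro u v h (hv | hv)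
    · exact .inl (P.prefixClosed h hv)
    · exact .inr (Q.prefixClosed h hv)
  proper := by
    rintro (h | h)
    · exact P.proper h
    · exact Q.proper h

/-- `{ε}`. -/
def omega : AProc V where
  carrier := {.nil}
  nonempty := ⟨.nil, rfl⟩
  prefixClosed := by rintro u v h rfl; cases h; rfl
  proper := by rintro ⟨⟩

/-- `{(s, s) u | u ∈ P} ∪ {ε}`. -/
def d (P : AProc V) : AProc V where
  carrier := {r | r = .nil ∨ ∃ s u, u ∈ P.carrier ∧ r = .step s s u}
  nonempty := ⟨.nil, .inl rfl⟩
  prefixClosed := by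
    rintro u v h (rfl | ⟨s, v, hv, rfl⟩)
    · cases h; exact .inl rfl
    · cases h with
      | nil => exact .inl rfl
      | step _ _ h => exact .inr ⟨s, _, P.prefixClosed h hv, rfl⟩
  proper := by rintro (h | ⟨s, v, hv, h⟩) <;> cases h

/-- The prefix closure of `{(s, s) Done}`. -/
def halt : AProc V where
  carrier := {r | ∃ s, r ≤ .step s s .done}
  nonempty := ⟨.nil, fun _ => 0, .nil _⟩
  prefixClosed := by
    rintro u v h ⟨s, hs⟩
    exact ⟨s, h.trans hs⟩
  proper := by rintro ⟨s, h⟩; cases h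

/-- The set of all shuffles of a member of `P` and a member of `Q`. -/
def shuffle (P Q : AProc V) : AProc V where
  carrier := {w | ∃ u ∈ P.carrier, ∃ v ∈ Q.carrier, PShuf u v w}
  nonempty := ⟨.nil, _, P.nil_mem, _, Q.nil_mem, .nil_nil⟩
  prefixClosed := by
    rintro w' w h ⟨u, hu, v, hv, hw⟩
    obtain ⟨u', hu', v', hv', hw'⟩ := hw.of_le h
    exact ⟨u', P.prefixClosed hu' hu, v', Q.prefixClosed hv' hv, hw'⟩
  proper := by
    rintro ⟨u, hu, v, hv, hw⟩
    cases hw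
    exact P.proper hu

end AProc

/-! ## The theory of processes -/

/-- Structures for the signature of the theory of processes. -/
structure LProcStr (V : Type*) (A : Type*) where
  update : V → ℕ → A → A
  lookup : V → (ℕ → A) → A
  union : A → A → A
  omega : A
  d : A → A
  async : AProc V → A → A
  yieldTo : AProc V → A → A

/-- The left action `P ⋈ x = (P ▷ x) ∪ (P ◁ x)`. -/
def LProcStr.act {V A : Type*} (M : LProcStr V A) (P : AProc V) (x : A) : A :=
  M.union (M.async P x) (M.yieldTo P x)

/-- Models of the theory of processes in the category of ω-cpos: the operations are continuous, also
in the parameter `P` of `async` and `yieldTo`, and satisfy the (in)equations of the theory. -/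
structure IsLProcModel {V A : Type*} [DecidableEq V] [OmegaCompletePartialOrder A]
    (M : LProcStr V A) : Prop where
  -- continuity
  continuous_update : ∀ l n, ωScottContinuous (M.update l n)
  continuous_lookup : ∀ l, ωScottContinuous (M.lookup l)
  continuous_union : ωScottContinuous fun p : A × A => M.union p.1 p.2
  continuous_d : ωScottContinuous M.d
  continuous_async : ωScottContinuous fun p : AProc V × A => M.async p.1 p.2
  continuous_yieldTo : ωScottContinuous fun p : AProc V × A => M.yieldTo p.1 p.2
  -- stores
  lookup_update_self : ∀ l x, M.lookup l (fun n => M.update l n x) = x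
  lookup_lookup_self : ∀ l (x : ℕ → ℕ → A),
    M.lookup l (fun m => M.lookup l (fun n => x m n)) = M.lookup l (fun n => x n n)
  update_update_self : ∀ l m n x, M.update l m (M.update l n x) = M.update l n x
  update_lookup_self : ∀ l n (x : ℕ → A), M.update l n (M.lookup l x) = M.update l n (x n)
  lookup_lookup : ∀ l k, l ≠ k → ∀ x : ℕ → ℕ → A,
    M.lookup l (fun m => M.lookup k (fun n => x m n)) =
      M.lookup k (fun n => M.lookup l (fun m => x m n))
  update_update : ∀ l k, l ≠ k → ∀ m n x,
    M.update l m (M.update k n x) = M.update k n (M.update l m x)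
  update_lookup : ∀ l k, l ≠ k → ∀ m (x : ℕ → A),
    M.update l m (M.lookup k x) = M.lookup k (fun n => M.update l m (x n))
  -- nondeterminism (lower powerdomain)
  union_assoc : ∀ x y z, M.union (M.union x y) z = M.union x (M.union y z)
  union_comm : ∀ x y, M.union x y = M.union y x
  union_self : ∀ x, M.union x x = x
  le_union : ∀ x y, x ≤ M.union x y
  -- nontermination
  omega_le : ∀ x, M.omega ≤ x
  -- commutation of stores with nontermination
  update_omega : ∀ l n, M.update l n M.omega = M.omega
  lookup_omega : ∀ l, M.lookup l (fun _ => M.omega) = M.omega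
  -- commutation of nondeterminism with stores, nontermination and suspension
  update_union : ∀ l n x y, M.update l n (M.union x y) = M.union (M.update l n x) (M.update l n y)
  lookup_union : ∀ l (x y : ℕ → A),
    M.lookup l (fun n => M.union (x n) (y n)) = M.union (M.lookup l x) (M.lookup l y)
  omega_union : M.union M.omega M.omega = M.omega
  d_union : ∀ x y, M.d (M.union x y) = M.union (M.d x) (M.d y)
  -- spawning: commutation with nondeterminism
  union_async : ∀ P P₂ x, M.async (P.union P₂) x = M.union (M.async P x) (M.async P₂ x)
  async_union : ∀ P x y, M.async P (M.union x y) = M.union (M.async P x) (M.async P y)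
  union_yieldTo : ∀ P P₂ x, M.yieldTo (P.union P₂) x = M.union (M.yieldTo P x) (M.yieldTo P₂ x)
  yieldTo_union : ∀ P x y, M.yieldTo P (M.union x y) = M.union (M.yieldTo P x) (M.yieldTo P y)
  -- spawning: interaction of `async` with the other operations
  async_update : ∀ P l n x, M.async P (M.update l n x) = M.update l n (M.async P x)
  async_lookup : ∀ P l (x : ℕ → A),
    M.async P (M.lookup l x) = M.lookup l (fun n => M.async P (x n))
  async_omega : ∀ P, M.async P M.omega = M.omega
  async_d : ∀ P x, M.async P (M.d x) = M.d (M.act P x)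
  async_async : ∀ P P₂ x, M.async P (M.async P₂ x) = M.async (P.shuffle P₂) x
  -- spawning: interaction of `yieldTo` with the operations on asynchronous processes
  update_yieldTo : ∀ P l n x, M.yieldTo (P.update l n) x = M.update l n (M.yieldTo P x)
  lookup_yieldTo : ∀ (P : ℕ → AProc V) l x,
    M.yieldTo (AProc.lookup l P) x = M.lookup l (fun n => M.yieldTo (P n) x)
  omega_yieldTo : ∀ x, M.yieldTo AProc.omega x = M.omega
  d_yieldTo : ∀ P x, M.yieldTo P.d x = M.d (M.act P x)
  halt_yieldTo : ∀ x, M.yieldTo AProc.halt x = M.d x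
  -- the inequation
  omega_async_le : ∀ x, M.async AProc.omega x ≤ x

/-- Morphisms of models: continuous maps that preserve all the operations. -/
structure IsLProcHom {V A B : Type*} [OmegaCompletePartialOrder A] [OmegaCompletePartialOrder B]
    (M : LProcStr V A) (N : LProcStr V B) (h : A → B) : Prop where
  continuous : ωScottContinuous h
  map_update : ∀ l n x, h (M.update l n x) = N.update l n (h x)
  map_lookup : ∀ l (x : ℕ → A), h (M.lookup l x) = N.lookup l (fun n => h (x n))
  map_union : ∀ x y, h (M.union x y) = N.union (h x) (h y)
  map_omega : h M.omega = N.omega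
  map_d : ∀ x, h (M.d x) = N.d (h x)
  map_async : ∀ P x, h (M.async P x) = N.async P (h x)
  map_yieldTo : ∀ P x, h (M.yieldTo P x) = N.yieldTo P (h x)

/-- Isomorphisms of models: morphisms with an inverse that is a morphism. -/
def IsLProcIso {V A B : Type*} [OmegaCompletePartialOrder A] [OmegaCompletePartialOrder B]
    (M : LProcStr V A) (N : LProcStr V B) (h : A → B) : Prop :=
  IsLProcHom M N h ∧
    ∃ g : B → A, IsLProcHom N M g ∧ Function.LeftInverse g h ∧ Function.RightInverse g h

/-- `M` is the free model of the theory of processes over the ω-cpo `X`, with unit `η`, as far as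
models whose carriers are in the universe `w` are concerned. -/
def IsFreeLProcModel.{w, x, a, v} {V : Type v} {X : Type x} {A : Type a} [DecidableEq V]
    [OmegaCompletePartialOrder X] [OmegaCompletePartialOrder A]
    (M : LProcStr V A) (η : X → A) : Prop :=
  IsLProcModel M ∧ ωScottContinuous η ∧
    ∀ (B : Type w) [OmegaCompletePartialOrder B] (N : LProcStr V B), IsLProcModel N →
      ∀ f : X → B, ωScottContinuous f → ∃! h : A → B, IsLProcHom M N h ∧ ∀ x, h (η x) = f x

/-! ## Ideals of `Q`-transition sequences -/

/-- The plain sequence `(s, t) u⁻`, where `u⁻` is `u` less any occurrence of `Done`. -/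
def BTrans.ofPure {V R : Type*} (s t : Store V) : PSeq V → BTrans V R
  | .nil => .last s t
  | .done => .last s t
  | .step s₂ t₂ u => .step s t (BTrans.ofPure s₂ t₂ u)

mutual

/-- The incomplete right shuffles `u ▷ v` of a pure transition sequence `u` with a
`Q`-transition sequence `v`. -/
def incRight {V Q : Type*} [PartialOrder Q] : PSeq V → QTrans V Q → LowerSet (QTrans V Q)
  | u, .last s t => lowerClosure {BTrans.ofPure s t u}
  | u, .lastRet s t (x, u₂) => lowerClosure {r | ∃ w, PShuf u u₂ w ∧ r = .lastRet s t (x, w)}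
  | u, .step s t v =>
      lowerClosure {r | ∃ w, (w ∈ incLeft u v ∨ w ∈ incRight u v) ∧ r = .step s t w}
termination_by u v => sizeOf u + sizeOf v

/-- The incomplete left shuffles `u ◁ v` of a proper pure transition sequence `u` with a
`Q`-transition sequence `v`. (The value at the improper sequence `u = Done` is never used.) -/
def incLeft {V Q : Type*} [PartialOrder Q] : PSeq V → QTrans V Q → LowerSet (QTrans V Q)
  | .nil, _ => ⊥
  | .done, _ => ⊥
  | .step s t .done, v => lowerClosure {.step s t v}
  | .step s t u, v =>
      lowerClosure {r | ∃ w, (w ∈ incLeft u v ∨ w ∈ incRight u v) ∧ r = .step s t w}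
termination_by u v => sizeOf u + sizeOf v

end

namespace Iomega

variable {V Q : Type*} [Finite V] [PartialOrder Q] [Countable Q]

/-- `{(s, τ) u | (s[l ↦ n], τ) u ∈ I}`. -/
def update [DecidableEq V] (l : V) (n : ℕ) (I : Iomega (QTrans V Q)) : Iomega (QTrans V Q) :=
  .ofLower {r | match r with
      | .last s t => .last (Function.update s l n) t ∈ I.carrier
      | .lastRet s t x => .lastRet (Function.update s l n) t x ∈ I.carrier
      | .step s t u => .step (Function.update s l n) t u ∈ I.carrier} <| by
    intro v u h hv
    cases h with
    | last s t => exact hv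
    | last_step s t u => exact I.lower (.last_step _ _ _) hv
    | lastRet s t h => exact I.lower (.lastRet _ _ h) hv
    | step s t h => exact I.lower (.step _ _ h) hv

/-- `⋃ n, {(s, τ) u ∈ I n | s l = n}`. -/
def lookup (l : V) (I : ℕ → Iomega (QTrans V Q)) : Iomega (QTrans V Q) :=
  .ofLower {r | ∃ n, r ∈ (I n).carrier ∧ match r with
      | .last s _ => s l = n
      | .lastRet s _ _ => s l = n
      | .step s _ _ => s l = n} <| by
    rintro v u h ⟨n, hv, hn⟩
    refine ⟨n, (I n).lower h hv, ?_⟩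
    cases h <;> exact hn

/-- Binary choice `I ∪ J`. -/
def union (I J : Iomega (QTrans V Q)) : Iomega (QTrans V Q) :=
  .ofLower (I.carrier ∪ J.carrier) (I.lower.union J.lower)

/-- The empty ideal. -/
def omega : Iomega (QTrans V Q) :=
  .ofLower ∅ isLowerSet_empty

/-- `{(s, s) u | u ∈ I} ∪ {(s, s)}`. -/
def d (I : Iomega (QTrans V Q)) : Iomega (QTrans V Q) :=
  .ofLower {r | (∃ s u, u ∈ I.carrier ∧ r = .step s s u) ∨ ∃ s, r = .last s s} <| by
    rintro v u h (⟨s, v, hv, rfl⟩ | ⟨s, rfl⟩)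
    · cases h with
      | last_step => exact .inr ⟨s, rfl⟩
      | step _ _ h => exact .inl ⟨s, _, I.lower h hv, rfl⟩
    · cases h with
      | last => exact .inr ⟨s, rfl⟩

/-- The union of all `u ▷ v` for `u ∈ P`, `v ∈ I`. -/
def async (P : AProc V) (I : Iomega (QTrans V Q)) : Iomega (QTrans V Q) :=
  .ofLower {r | ∃ u ∈ P.carrier, ∃ v ∈ I.carrier, r ∈ incRight u v} <| by
    rintro b a h ⟨u, hu, v, hv, hr⟩
    exact ⟨u, hu, v, hv, (incRight u v).lower h hr⟩

/-- The union of all `u ◁ v` for `u ∈ P`, `v ∈ I`, together with all `u⁻` for non-empty `u ∈ P`. -/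
def yieldTo (P : AProc V) (I : Iomega (QTrans V Q)) : Iomega (QTrans V Q) :=
  .ofLower {r | (∃ u ∈ P.carrier, ∃ v ∈ I.carrier, r ∈ incLeft u v) ∨
      ∃ s t u, PSeq.step s t u ∈ P.carrier ∧ r = BTrans.ofPure s t u} <| by
    have key : ∀ (u : PSeq V) (s t : Store V) (a : QTrans V Q), a ≤ BTrans.ofPure s t u →
        ∃ u₂ ≤ u, a = BTrans.ofPure s t u₂ := by
      intro u
      induction u with
      | nil => intro s t a h; cases h; exact ⟨_, le_rfl, rfl⟩
      | done => intro s t a h; cases h; exact ⟨_, le_rfl, rfl⟩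
      | step s₂ t₂ u ih =>
        intro s t a h
        cases h with
        | last_step => exact ⟨.nil, .nil _, rfl⟩
        | step _ _ h =>
          obtain ⟨u₂, hu, rfl⟩ := ih _ _ _ h
          exact ⟨.step s₂ t₂ u₂, .step _ _ hu, rfl⟩
    rintro b a h (⟨u, hu, v, hv, hr⟩ | ⟨s, t, u, hu, rfl⟩)
    · exact .inl ⟨u, hu, v, hv, (incLeft u v).lower h hr⟩
    · obtain ⟨u₂, h₂, rfl⟩ := key _ _ _ _ h
      exact .inr ⟨s, t, u₂, P.prefixClosed (.step _ _ h₂) hu, rfl⟩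

/-- The structure on the denumerably generated ideals of `Q`-transition sequences. -/
def str (V Q : Type*) [Finite V] [DecidableEq V] [PartialOrder Q] [Countable Q] :
    LProcStr V (Iomega (QTrans V Q)) where
  update := update
  lookup := lookup
  union := union
  omega := omega
  d := d
  async := async
  yieldTo := yieldTo

end Iomega

/-! ## Operations on processes -/

namespace Proc

variable {V : Type*}

/-- `{(s, τ) u | (s[l ↦ n], τ) u ∈ P} ∪ {ε}`. -/
def update [DecidableEq V] (l : V) (n : ℕ) (P : Proc V) : Proc V where
  carrier := {r | match r with
    | .nil => True
    | .step s t u => .step (Function.update s l n) t u ∈ P.carrier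
    | .ret s t u => .ret (Function.update s l n) t u ∈ P.carrier}
  nonempty := ⟨.nil, trivial⟩
  prefixClosed := by
    intro u v h hv
    cases h with
    | nil => trivial
    | step s t h => exact P.prefixClosed (.step _ _ h) hv
    | ret s t h => exact P.prefixClosed (.ret _ _ h) hv

/-- `⋃ n, {(s, τ) u ∈ P n | s l = n} ∪ {ε}`. -/
def lookup (l : V) (P : ℕ → Proc V) : Proc V where
  carrier := {r | r = .nil ∨ ∃ n, r ∈ (P n).carrier ∧ match r with
    | .nil => False
    | .step s _ _ => s l = n
    | .ret s _ _ => s l = n}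
  nonempty := ⟨.nil, .inl rfl⟩
  prefixClosed := by
    rintro u v h (rfl | ⟨n, hv, hn⟩)
    · cases h; exact .inl rfl
    · have hu := (P n).prefixClosed h hv
      cases h with
      | nil => exact .inl rfl
      | step s t h => exact .inr ⟨n, hu, hn⟩
      | ret s t h => exact .inr ⟨n, hu, hn⟩

/-- Binary choice `P ∪ Q`. -/
def union (P Q : Proc V) : Proc V where
  carrier := P.carrier ∪ Q.carrier
  nonempty := P.nonempty.inl
  prefixClosed := by
    rintro u v h (hv | hv)
    · exact .inl (P.prefixClosed h hv)
    · exact .inr (Q.prefixClosed h hv)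

/-- `{ε}`. -/
def omega : Proc V where
  carrier := {.nil}
  nonempty := ⟨.nil, rfl⟩
  prefixClosed := by rintro u v h rfl; cases h; rfl

/-- `{(s, s) u | u ∈ P} ∪ {ε}`. -/
def d (P : Proc V) : Proc V where
  carrier := {r | r = .nil ∨ ∃ s u, u ∈ P.carrier ∧ r = .step s s u}
  nonempty := ⟨.nil, .inl rfl⟩
  prefixClosed := by
    rintro u v h (rfl | ⟨s, v, hv, rfl⟩)
    · cases h; exact .inl rfl
    · cases h with
      | nil => exact .inl rfl
      | step _ _ h => exact .inr ⟨s, _, P.prefixClosed h hv, rfl⟩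

/-- `async(P, Q)`, the union of all `u ▷ v` for `u ∈ P`, `v ∈ Q`. -/
def async (P : AProc V) (Q : Proc V) : Proc V where
  carrier := {r | ∃ u ∈ P.carrier, ∃ v ∈ Q.carrier, r ∈ rightShuffle u v}
  nonempty := ⟨.nil, .nil, P.nil_mem, .nil, Q.nil_mem, rfl⟩
  prefixClosed := by
    rintro b a h ⟨u, hu, v, hv, hr⟩
    cases v with
    | nil => cases hr; cases h; exact ⟨u, hu, .nil, hv, rfl⟩
    | step s t v =>
      obtain ⟨w, hw, rfl⟩ := hr
      cases h with
      | nil => exact ⟨u, hu, .nil, Q.nil_mem, rfl⟩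
      | step _ _ h =>
        obtain ⟨u₂, hu₂, v₂, hv₂, hw₂⟩ := hw.of_le h
        exact ⟨u₂, P.prefixClosed hu₂ hu, .step s t v₂, Q.prefixClosed (.step s t hv₂) hv,
          _, hw₂, rfl⟩
    | ret s t v =>
      obtain ⟨w, hw, rfl⟩ := hr
      cases h with
      | nil => exact ⟨u, hu, .nil, Q.nil_mem, rfl⟩
      | ret _ _ h =>
        obtain ⟨u₂, hu₂, v₂, hv₂, hw₂⟩ := hw.of_le h
        exact ⟨u₂, P.prefixClosed hu₂ hu, .ret s t v₂, Q.prefixClosed (.ret s t hv₂) hv,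
          _, hw₂, rfl⟩

/-- The union of all `u ◁ v` for `u ∈ P`, `v ∈ Q`. -/
def yieldTo (P : AProc V) (Q : Proc V) : Proc V where
  carrier := {r | ∃ u ∈ P.carrier, ∃ v ∈ Q.carrier, r ∈ leftShuffle u v}
  nonempty := ⟨.nil, .nil, P.nil_mem, .nil, Q.nil_mem, rfl⟩
  prefixClosed := by
    rintro b a h ⟨u, hu, v, hv, hr⟩
    cases u with
    | nil => cases hr; cases h; exact ⟨.nil, hu, v, hv, rfl⟩
    | done => exact absurd hu P.proper
    | step s t u =>
      obtain ⟨w, hw, rfl⟩ := hr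
      cases h with
      | nil => exact ⟨.nil, P.nil_mem, v, hv, rfl⟩
      | step _ _ h =>
        obtain ⟨u₂, hu₂, v₂, hv₂, hw₂⟩ := hw.of_le h
        exact ⟨.step s t u₂, P.prefixClosed (.step s t hu₂) hu, v₂, Q.prefixClosed hv₂ hv,
          _, hw₂, rfl⟩

/-- The structure on the processes. -/
def str (V : Type*) [DecidableEq V] : LProcStr V (Proc V) where
  update := update
  lookup := lookup
  union := union
  omega := omega
  d := d
  async := async
  yieldTo := yieldTo

/-- The denotation of `skip`: the prefix closure of `{(s, s Ret) Done}`. -/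
def skip : Proc V where
  carrier := {r | ∃ s, r ≤ .ret s s .done}
  nonempty := ⟨.nil, fun _ => 0, .nil _⟩
  prefixClosed := by
    rintro u v h ⟨s, hs⟩
    exact ⟨s, h.trans hs⟩

end Proc

/-- `l v`, for a finite sequence `l` of plain transitions. -/
def TSeq.append {V : Type*} (l : List (Store V × Store V)) (v : TSeq V) : TSeq V :=
  l.foldr (fun p u => .step p.1 p.2 u) v

theorem TSeq.le_append {V : Type*} {l : List (Store V × Store V)} {u v : TSeq V}
    (h : u ≤ TSeq.append l v) :
    (∃ l₂, u = TSeq.append l₂ .nil ∧ ∀ w, u ≤ TSeq.append l w) ∨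
      ∃ v₂ ≤ v, u = TSeq.append l v₂ := by
  induction l generalizing u with
  | nil => exact .inr ⟨u, h, rfl⟩
  | cons p l ih =>
    cases h with
    | nil => exact .inl ⟨[], rfl, fun w => .nil _⟩
    | step _ _ h =>
      rcases ih h with ⟨l₂, rfl, hl⟩ | ⟨v₂, hv, rfl⟩
      · exact .inl ⟨p :: l₂, rfl, fun w => .step _ _ (hl w)⟩
      · exact .inr ⟨v₂, hv, rfl⟩

/-- Composition `P ∘ Q` of processes: the sequences `l (s, τ) v` such that there are `t`, `w` and
`w₂` with `l (s, t Ret) w ∈ P`, `(t, τ) w₂ ∈ Q` and `v` a shuffle of `w` and `w₂`, together with the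
sequences in `P` without return transition. Here `τ` is a store `t₂` or a marked store
`t₂ Ret`. -/
def Proc.comp {V : Type*} (P Q : Proc V) : Proc V where
  carrier := {r |
    (∃ l s t t₂ w w₂ v, TSeq.append l (.ret s t w) ∈ P.carrier ∧ TSeq.step t t₂ w₂ ∈ Q.carrier ∧
      TShuf w w₂ v ∧ r = TSeq.append l (.step s t₂ v)) ∨
    (∃ l s t t₂ w w₂ v, TSeq.append l (.ret s t w) ∈ P.carrier ∧ TSeq.ret t t₂ w₂ ∈ Q.carrier ∧
      PShuf w w₂ v ∧ r = TSeq.append l (.ret s t₂ v)) ∨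
    (r ∈ P.carrier ∧ ∃ l, r = TSeq.append l .nil)}
  nonempty := ⟨.nil, .inr (.inr ⟨P.nil_mem, [], rfl⟩)⟩
  prefixClosed := by
    have mono : ∀ (l : List (Store V × Store V)) {u v : TSeq V}, u ≤ v →
        TSeq.append l u ≤ TSeq.append l v := by
      intro l u v h
      induction l with
      | nil => exact h
      | cons p l ih => exact .step _ _ ih
    rintro b a h (⟨l, s, t, t₂, w, w₂, v, hP, hQ, hv, rfl⟩ | ⟨l, s, t, t₂, w, w₂, v, hP, hQ, hv, rfl⟩ |
      ⟨hP, l, rfl⟩)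
    · rcases TSeq.le_append h with ⟨l₂, hl, hle⟩ | ⟨b, hb, rfl⟩
      · exact .inr (.inr ⟨P.prefixClosed (hle _) hP, l₂, hl⟩)
      · cases hb with
        | nil => exact .inr (.inr ⟨P.prefixClosed (mono l (.nil _)) hP, l, rfl⟩)
        | step _ _ hb =>
          obtain ⟨w', hw', w₂', hw₂', hs⟩ := hv.of_le hb
          exact .inl ⟨l, s, t, t₂, w', w₂', _, P.prefixClosed (mono l (.ret _ _ hw')) hP,
            Q.prefixClosed (.step _ _ hw₂') hQ, hs, rfl⟩
    · rcases TSeq.le_append h with ⟨l₂, hl, hle⟩ | ⟨b, hb, rfl⟩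
      · exact .inr (.inr ⟨P.prefixClosed (hle _) hP, l₂, hl⟩)
      · cases hb with
        | nil => exact .inr (.inr ⟨P.prefixClosed (mono l (.nil _)) hP, l, rfl⟩)
        | ret _ _ hb =>
          obtain ⟨w', hw', w₂', hw₂', hs⟩ := hv.of_le hb
          exact .inr (.inl ⟨l, s, t, t₂, w', w₂', _, P.prefixClosed (mono l (.ret _ _ hw')) hP,
            Q.prefixClosed (.ret _ _ hw₂') hQ, hs, rfl⟩)
    · refine .inr (.inr ⟨P.prefixClosed h hP, ?_⟩)
      rcases TSeq.le_append h with ⟨l₂, hl, -⟩ | ⟨b, hb, rfl⟩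
      · exact ⟨l₂, hl⟩
      · cases hb; exact ⟨l, rfl⟩

/-! ## The isomorphism -/

/-- The map from `{Ret}`-transition sequences to transition sequences that fixes
the plain sequences and sends `u (s, t (Ret, v))` to `u (s, t Ret) v`. -/
def theta {V : Type*} : QTrans V RetPoint → TSeq V
  | .last s t => .step s t .nil
  | .lastRet s t (.Ret, v) => .ret s t v
  | .step s t u => .step s t (theta u)

theorem theta_of_le {V : Type*} {a : TSeq V} {v : QTrans V RetPoint} (h : a ≤ theta v) :
    a = .nil ∨ ∃ u ≤ v, a = theta u := by
  induction v generalizing a with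
  | last s t =>
    cases h with
    | nil => exact .inl rfl
    | step _ _ h => cases h; exact .inr ⟨.last s t, le_rfl, rfl⟩
  | lastRet s t x =>
    obtain ⟨⟨⟩, v⟩ := x
    cases h with
    | nil => exact .inl rfl
    | ret _ _ h => exact .inr ⟨_, .lastRet s t (x := (.Ret, _)) ⟨trivial, h⟩, rfl⟩
  | step s t v ih =>
    cases h with
    | nil => exact .inl rfl
    | step _ _ h =>
      rcases ih h with rfl | ⟨u, hu, rfl⟩
      · exact .inr ⟨.last s t, .last_step _ _ _, rfl⟩
      · exact .inr ⟨.step s t u, .step _ _ hu, rfl⟩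

/-- `I ↦ θ(I) ∪ {ε}`. -/
def thetaTilde {V : Type*} (I : Iomega (QTrans V RetPoint)) : Proc V where
  carrier := theta '' I.carrier ∪ {.nil}
  nonempty := ⟨.nil, .inr rfl⟩
  prefixClosed := by
    rintro b a h (⟨v, hv, rfl⟩ | rfl)
    · rcases theta_of_le h with rfl | ⟨u, hu, rfl⟩
      · exact .inr rfl
      · exact .inl ⟨u, I.lower hu hv, rfl⟩
    · cases h; exact .inr rfl

end CoopThreads

end

open CoopThreads

universe v w

namespace CoopThreads

variable {V : Type*}

/-! ## Associativity of shuffles -/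

-- `Proc.isLProcModel` is checked on elements. Every process contains the empty sequence, so each
-- law reduces to an equivalence between memberships of non-empty sequences. The only laws with
-- combinatorial content are those for spawning, which rest on the associativity of shuffles and on
-- the facts that `Done` is neutral for shuffling while the empty sequence only produces prefixes.
-- The map `theta` is an order isomorphism from the marked sequences onto the non-empty transition
-- sequences, so `thetaTilde` is an isomorphism of posets. It preserves the operations because an
-- incomplete shuffle is a shuffle up to passing to prefixes (`mem_incRight`, `mem_incLeft`). The
-- ideals then inherit the laws from the processes (`IsLProcModel.of_orderIso`).
--
-- Freeness rests on two observations. In any model, union is the binary join, so non-empty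
-- countable sups exist, and a continuous map that preserves union preserves them
-- (`IsLProcModel.preserves`). On the other side, there are only countably many sequences, since the
-- set of variables is finite. Hence a process is a countable sup of principal ideals, and each
-- principal ideal is built from `skip` by whole-store transitions, `d` and `async`
-- (`Proc.below_step`, `Proc.below_ret`, `Proc.below_ret_done`). A morphism is therefore determined
-- by its value at `skip`.
--
-- For existence, the same expressions, evaluated in the target model with `skip` replaced by `a`,
-- define `liftSeq` on sequences. This is monotone, the inequation for `async` being what handles a
-- missing `Done`, and `lift` takes sups. Compatibility with the store operations, `d` and `skip` is
-- verified for one initial store at a time. This is enough by `IsLProcModel.le_of_setStore_le`: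
-- looking up what has just been assigned changes nothing, so elements can be compared after fixing
-- the store. Compatibility with `async` and `yieldTo` is an induction on principal ideals that uses
-- the interaction laws.
--
-- The Kleisli extension is `lift` with target the processes themselves. Composition preserves sups
-- on the left and agrees with `liftSeq` on principal ideals (`Proc.liftSeq_eq_comp`), so the two
-- coincide.

/-- Each transition of a threefold shuffle comes from one of three sources, so the bracketing can be
changed one transition at a time; `Done` survives exactly if all three sequences end in it. The four
associativity lemmas give the law for nested `async`. -/
theorem PShuf.assoc_left {u₁ u₂ v w₁ w : PSeq V} (h : PShuf u₁ w₁ w) (k : PShuf u₂ v w₁) :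
    ∃ u, PShuf u₁ u₂ u ∧ PShuf u v w := by
  induction h generalizing u₂ v with
  | nil_nil => cases k <;> exact ⟨_, by constructor, by constructor⟩
  | nil_done => cases k; exact ⟨_, .nil_done, .nil_done⟩
  | done_nil => cases k <;> exact ⟨_, by constructor, by constructor⟩
  | done_done => cases k; exact ⟨_, .done_done, .done_done⟩
  | left s t h ih =>
    obtain ⟨u, hu, hw⟩ := ih k
    exact ⟨_, .left s t hu, .left s t hw⟩
  | right s t h ih =>
    cases k with
    | left _ _ k =>
      obtain ⟨u, hu, hw⟩ := ih k
      exact ⟨_, .right s t hu, .left s t hw⟩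
    | right _ _ k =>
      obtain ⟨u, hu, hw⟩ := ih k
      exact ⟨_, hu, .right s t hw⟩

theorem PShuf.assoc_right {u₁ u₂ v u w : PSeq V} (h : PShuf u v w) (k : PShuf u₁ u₂ u) :
    ∃ w₁, PShuf u₂ v w₁ ∧ PShuf u₁ w₁ w := by
  induction h generalizing u₁ u₂ with
  | nil_nil => cases k <;> exact ⟨_, by constructor, by constructor⟩
  | nil_done => cases k <;> exact ⟨_, by constructor, by constructor⟩
  | done_nil => cases k; exact ⟨_, .done_nil, .done_nil⟩
  | done_done => cases k; exact ⟨_, .done_done, .done_done⟩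
  | left s t h ih =>
    cases k with
    | left _ _ k =>
      obtain ⟨u, hu, hw⟩ := ih k
      exact ⟨_, hu, .left s t hw⟩
    | right _ _ k =>
      obtain ⟨u, hu, hw⟩ := ih k
      exact ⟨_, .left s t hu, .right s t hw⟩
  | right s t h ih =>
    obtain ⟨u, hu, hw⟩ := ih k
    exact ⟨_, .right s t hu, .right s t hw⟩

theorem TShuf.assoc_left {u₁ u₂ : PSeq V} {v w₁ w : TSeq V} (h : TShuf u₁ w₁ w)
    (k : TShuf u₂ v w₁) : ∃ u, PShuf u₁ u₂ u ∧ TShuf u v w := by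
  induction h generalizing u₂ v with
  | nil_nil => cases k <;> exact ⟨_, by constructor, by constructor⟩
  | done_nil => cases k <;> exact ⟨_, by constructor, by constructor⟩
  | left s t h ih =>
    obtain ⟨u, hu, hw⟩ := ih k
    exact ⟨_, .left s t hu, .left s t hw⟩
  | right s t h ih =>
    cases k with
    | left _ _ k =>
      obtain ⟨u, hu, hw⟩ := ih k
      exact ⟨_, .right s t hu, .left s t hw⟩
    | right _ _ k =>
      obtain ⟨u, hu, hw⟩ := ih k
      exact ⟨_, hu, .right s t hw⟩
  | @left_ret s t _ _ _ h =>
    generalize hr : TSeq.ret s t _ = r at k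
    induction k with
    | nil_nil => cases hr
    | done_nil => cases hr
    | left => cases hr
    | right => cases hr
    | left_ret _ _ k =>
      cases hr
      obtain ⟨u, hu, hw⟩ := h.assoc_left k
      exact ⟨_, hu, .left_ret s t hw⟩

theorem TShuf.assoc_right {u₁ u₂ u : PSeq V} {v w : TSeq V} (h : TShuf u v w)
    (k : PShuf u₁ u₂ u) : ∃ w₁, TShuf u₂ v w₁ ∧ TShuf u₁ w₁ w := by
  induction h generalizing u₁ u₂ with
  | nil_nil => cases k <;> exact ⟨_, by constructor, by constructor⟩
  | done_nil => cases k; exact ⟨_, .done_nil, .done_nil⟩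
  | left s t h ih =>
    cases k with
    | left _ _ k =>
      obtain ⟨u, hu, hw⟩ := ih k
      exact ⟨_, hu, .left s t hw⟩
    | right _ _ k =>
      obtain ⟨u, hu, hw⟩ := ih k
      exact ⟨_, .left s t hu, .right s t hw⟩
  | right s t h ih =>
    obtain ⟨u, hu, hw⟩ := ih k
    exact ⟨_, .right s t hu, .right s t hw⟩
  | left_ret s t h =>
    obtain ⟨u, hu, hw⟩ := h.assoc_right k
    exact ⟨_, .left_ret s t hu, .left_ret s t hw⟩

-- Shuffles with the empty sequence and with `Done`

/-- The empty sequence is not neutral: a shuffle with it loses a final `Done`. This is why spawning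
the trivial process satisfies only an inequation. -/
theorem PShuf.le_of_nil {v w : PSeq V} (h : PShuf .nil v w) : w ≤ v := by
  generalize hu : PSeq.nil = u at h
  induction h with
  | nil_nil => exact le_rfl
  | nil_done => exact .nil _
  | done_nil => cases hu
  | done_done => cases hu
  | left => cases hu
  | right s t h ih => exact .step s t (ih hu)

theorem TShuf.le_of_nil {v w : TSeq V} (h : TShuf .nil v w) : w ≤ v := by
  generalize hu : PSeq.nil = u at h
  induction h with
  | nil_nil => exact le_rfl
  | done_nil => exact le_rfl
  | left => cases hu
  | right s t h ih => exact .step s t (ih hu)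
  | left_ret s t h => subst hu; exact .ret s t h.le_of_nil

/-- `Done` contributes no transition and never vetoes the `Done` of the other sequence, so it is the
true unit for shuffling. -/
theorem PShuf.done_left_iff {v w : PSeq V} : PShuf .done v w ↔ w = v := by
  constructor
  · intro h
    generalize hu : PSeq.done = u at h
    induction h with
    | nil_nil => rfl
    | nil_done => cases hu
    | done_nil => rfl
    | done_done => rfl
    | left => cases hu
    | right s t h ih => rw [ih hu]
  · rintro rfl
    induction w with
    | nil => exact .done_nil
    | done => exact .done_done
    | step s t w ih => exact .right s t ih

theorem PShuf.comm {u v w : PSeq V} (h : PShuf u v w) : PShuf v u w := by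
  induction h with
  | left s t h ih => exact .right s t ih
  | right s t h ih => exact .left s t ih
  | _ => constructor

theorem PShuf.done_right_iff {v w : PSeq V} : PShuf v .done w ↔ w = v :=
  ⟨fun h => PShuf.done_left_iff.1 h.comm, fun h => (PShuf.done_left_iff.2 h).comm⟩

theorem TShuf.done_left_iff {v w : TSeq V} : TShuf .done v w ↔ w = v := by
  constructor
  · intro h
    generalize hu : PSeq.done = u at h
    induction h with
    | nil_nil => rfl
    | done_nil => rfl
    | left => cases hu
    | right s t h ih => rw [ih hu]
    | left_ret s t h => subst hu; rw [PShuf.done_left_iff.1 h]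
  · rintro rfl
    induction w with
    | nil => exact .done_nil
    | step s t w ih => exact .right s t ih
    | ret s t w => exact .left_ret s t (PShuf.done_left_iff.2 rfl)

/-! ## Membership -/

namespace Proc

theorem mem_ωSup {c : Chain (Proc V)} {r : TSeq V} :
    r ∈ (ωSup c).carrier ↔ ∃ i, r ∈ (c i).carrier := Set.mem_iUnion

theorem ext_steps {P Q : Proc V}
    (hs : ∀ s t u, TSeq.step s t u ∈ P.carrier ↔ TSeq.step s t u ∈ Q.carrier)
    (hr : ∀ s t u, TSeq.ret s t u ∈ P.carrier ↔ TSeq.ret s t u ∈ Q.carrier) : P = Q := by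
  ext r
  cases r with
  | nil => simp [nil_mem]
  | step => exact hs _ _ _
  | ret => exact hr _ _ _

theorem le_of_steps {P Q : Proc V}
    (hs : ∀ s t u, TSeq.step s t u ∈ P.carrier → TSeq.step s t u ∈ Q.carrier)
    (hr : ∀ s t u, TSeq.ret s t u ∈ P.carrier → TSeq.ret s t u ∈ Q.carrier) : P ≤ Q := by
  intro r h
  cases r with
  | nil => exact nil_mem Q
  | step => exact hs _ _ _ h
  | ret => exact hr _ _ _ h

/-- Sups of chains are unions, so beyond monotonicity it suffices that each element of the value at
a sup already appears at some stage. -/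
theorem ωScottContinuous_of_mem {α : Type*} [OmegaCompletePartialOrder α] {F : α → Proc V}
    (hm : Monotone F)
    (h : ∀ (c : Chain α) r, r ∈ (F (ωSup c)).carrier → ∃ i, r ∈ (F (c i)).carrier) :
    ωScottContinuous F := by
  refine ωScottContinuous.of_monotone_map_ωSup ⟨hm, fun c => le_antisymm ?_ ?_⟩
  · intro r hr
    exact mem_ωSup.2 (h c r hr)
  · exact ωSup_le _ _ fun i => hm (le_ωSup c i)

section

variable {P P₁ P₂ : AProc V} {Q Q₁ Q₂ : Proc V} {R : ℕ → Proc V} {l : V} {n : ℕ} {s t : Store V}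
  {u : TSeq V} {w : PSeq V}

@[simp] theorem step_mem_update [DecidableEq V] :
    TSeq.step s t u ∈ (update l n Q).carrier ↔
      TSeq.step (Function.update s l n) t u ∈ Q.carrier := Iff.rfl

@[simp] theorem ret_mem_update [DecidableEq V] :
    TSeq.ret s t w ∈ (update l n Q).carrier ↔
      TSeq.ret (Function.update s l n) t w ∈ Q.carrier := Iff.rfl

@[simp] theorem step_mem_lookup :
    TSeq.step s t u ∈ (lookup l R).carrier ↔ TSeq.step s t u ∈ (R (s l)).carrier := by
  simp [lookup]

@[simp] theorem ret_mem_lookup :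
    TSeq.ret s t w ∈ (lookup l R).carrier ↔ TSeq.ret s t w ∈ (R (s l)).carrier := by
  simp [lookup]

@[simp] theorem mem_union : u ∈ (union Q₁ Q₂).carrier ↔ u ∈ Q₁.carrier ∨ u ∈ Q₂.carrier := Iff.rfl

@[simp] theorem mem_omega : u ∈ (omega : Proc V).carrier ↔ u = .nil := Iff.rfl

@[simp] theorem step_mem_d : TSeq.step s t u ∈ (d Q).carrier ↔ t = s ∧ u ∈ Q.carrier := by
  simp only [d, Set.mem_ofPred_eq, reduceCtorEq, false_or, TSeq.step.injEq]
  constructor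
  · rintro ⟨_, _, h, rfl, rfl, rfl⟩; exact ⟨rfl, h⟩
  · rintro ⟨rfl, h⟩; exact ⟨_, _, h, rfl, rfl, rfl⟩

@[simp] theorem ret_notMem_d : TSeq.ret s t w ∉ (d Q).carrier := by
  simp [d]

@[simp] theorem step_mem_async : TSeq.step s t u ∈ (async P Q).carrier ↔
    ∃ v ∈ P.carrier, ∃ v₂, TSeq.step s t v₂ ∈ Q.carrier ∧ TShuf v v₂ u := by
  constructor
  · rintro ⟨v, hv, v₂, hv₂, h⟩
    cases v₂ with
    | nil => cases h
    | step _ _ v₂ => obtain ⟨_, h, ⟨⟩⟩ := h; exact ⟨v, hv, v₂, hv₂, h⟩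
    | ret => obtain ⟨_, h, ⟨⟩⟩ := h
  · rintro ⟨v, hv, v₂, hv₂, h⟩
    exact ⟨v, hv, _, hv₂, _, h, rfl⟩

@[simp] theorem ret_mem_async : TSeq.ret s t w ∈ (async P Q).carrier ↔
    ∃ v ∈ P.carrier, ∃ v₂, TSeq.ret s t v₂ ∈ Q.carrier ∧ PShuf v v₂ w := by
  constructor
  · rintro ⟨v, hv, v₂, hv₂, h⟩
    cases v₂ with
    | nil => cases h
    | step => obtain ⟨_, h, ⟨⟩⟩ := h
    | ret _ _ v₂ => obtain ⟨_, h, ⟨⟩⟩ := h; exact ⟨v, hv, v₂, hv₂, h⟩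
  · rintro ⟨v, hv, v₂, hv₂, h⟩
    exact ⟨v, hv, _, hv₂, _, h, rfl⟩

@[simp] theorem step_mem_yieldTo : TSeq.step s t u ∈ (yieldTo P Q).carrier ↔
    ∃ v, PSeq.step s t v ∈ P.carrier ∧ ∃ v₂ ∈ Q.carrier, TShuf v v₂ u := by
  constructor
  · rintro ⟨v, hv, v₂, hv₂, h⟩
    cases v with
    | nil => cases h
    | done => cases h
    | step _ _ v => obtain ⟨_, h, ⟨⟩⟩ := h; exact ⟨v, hv, v₂, hv₂, h⟩
  · rintro ⟨v, hv, v₂, hv₂, h⟩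
    exact ⟨_, hv, v₂, hv₂, _, h, rfl⟩

@[simp] theorem ret_notMem_yieldTo : TSeq.ret s t w ∉ (yieldTo P Q).carrier := by
  rintro ⟨v, hv, v₂, hv₂, h⟩
  cases v with
  | nil => cases h
  | done => cases h
  | step _ _ v => obtain ⟨_, h, ⟨⟩⟩ := h

/-- A non-empty shuffle begins with a transition from one of its two arguments, which decides
between `yieldTo` and `async`. A return transition can only come from the main thread. -/
theorem mem_act [DecidableEq V] :
    u ∈ ((str V).act P Q).carrier ↔ ∃ v ∈ P.carrier, ∃ v₂ ∈ Q.carrier, TShuf v v₂ u := by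
  change u ∈ (union (async P Q) (yieldTo P Q)).carrier ↔ _
  constructor
  · cases u with
    | nil => exact fun _ => ⟨_, P.nil_mem, _, Q.nil_mem, .nil_nil⟩
    | step s t u =>
      simp only [mem_union, step_mem_async, step_mem_yieldTo]
      rintro (⟨v, hv, v₂, hv₂, h⟩ | ⟨v, hv, v₂, hv₂, h⟩)
      · exact ⟨v, hv, _, hv₂, .right s t h⟩
      · exact ⟨_, hv, _, hv₂, .left s t h⟩
    | ret s t u =>
      simp only [mem_union, ret_mem_async, ret_notMem_yieldTo, or_false]
      rintro ⟨v, hv, v₂, hv₂, h⟩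
      exact ⟨v, hv, _, hv₂, .left_ret s t h⟩
  · rintro ⟨v, hv, v₂, hv₂, h⟩
    cases h with
    | nil_nil => exact nil_mem _
    | done_nil => exact nil_mem _
    | left s t h => exact .inr (step_mem_yieldTo.2 ⟨_, hv, _, hv₂, h⟩)
    | right s t h => exact .inl (step_mem_async.2 ⟨_, hv, _, hv₂, h⟩)
    | left_ret s t h => exact .inl (ret_mem_async.2 ⟨_, hv, _, hv₂, h⟩)

end

end Proc

namespace AProc

variable {P P₁ P₂ : AProc V} {R : ℕ → AProc V} {l : V} {n : ℕ} {s t : Store V} {u : PSeq V}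

theorem mem_ωSup {c : Chain (AProc V)} :
    u ∈ (ωSup c).carrier ↔ ∃ i, u ∈ (c i).carrier := Set.mem_iUnion

theorem le_of_steps
    (hs : ∀ s t u, PSeq.step s t u ∈ P₁.carrier → PSeq.step s t u ∈ P₂.carrier) : P₁ ≤ P₂ := by
  intro r h
  cases r with
  | nil => exact nil_mem _
  | done => exact absurd h P₁.proper
  | step => exact hs _ _ _ h

theorem ext_steps
    (hs : ∀ s t u, PSeq.step s t u ∈ P₁.carrier ↔ PSeq.step s t u ∈ P₂.carrier) : P₁ = P₂ :=
  le_antisymm (le_of_steps fun _ _ _ => (hs _ _ _).1) (le_of_steps fun _ _ _ => (hs _ _ _).2)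

@[simp] theorem step_mem_update [DecidableEq V] :
    PSeq.step s t u ∈ (update l n P).carrier ↔
      PSeq.step (Function.update s l n) t u ∈ P.carrier := by
  simp only [update, Set.mem_ofPred_eq, reduceCtorEq, false_or, PSeq.step.injEq]
  constructor
  · rintro ⟨_, _, _, h, rfl, rfl, rfl⟩; exact h
  · exact fun h => ⟨_, _, _, h, rfl, rfl, rfl⟩

@[simp] theorem step_mem_lookup :
    PSeq.step s t u ∈ (lookup l R).carrier ↔ PSeq.step s t u ∈ (R (s l)).carrier := by
  simp only [lookup, Set.mem_ofPred_eq, reduceCtorEq, false_or, PSeq.step.injEq]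
  constructor
  · rintro ⟨_, _, _, _, h, rfl, rfl, rfl, rfl⟩; exact h
  · exact fun h => ⟨_, _, _, _, h, rfl, rfl, rfl, rfl⟩

@[simp] theorem mem_union : u ∈ (union P₁ P₂).carrier ↔ u ∈ P₁.carrier ∨ u ∈ P₂.carrier := Iff.rfl

@[simp] theorem mem_omega : u ∈ (omega : AProc V).carrier ↔ u = .nil := Iff.rfl

@[simp] theorem step_mem_d : PSeq.step s t u ∈ (d P).carrier ↔ t = s ∧ u ∈ P.carrier := by
  simp only [d, Set.mem_ofPred_eq, reduceCtorEq, false_or, PSeq.step.injEq]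
  constructor
  · rintro ⟨_, _, h, rfl, rfl, rfl⟩; exact ⟨rfl, h⟩
  · rintro ⟨rfl, h⟩; exact ⟨_, _, h, rfl, rfl, rfl⟩

@[simp] theorem step_mem_halt :
    PSeq.step s t u ∈ (halt : AProc V).carrier ↔ t = s ∧ u ≤ .done := by
  constructor
  · rintro ⟨s', h⟩; cases h with | step _ _ h => exact ⟨rfl, h⟩
  · rintro ⟨rfl, h⟩; exact ⟨_, .step _ _ h⟩

theorem mem_shuffle :
    u ∈ (P₁.shuffle P₂).carrier ↔ ∃ v ∈ P₁.carrier, ∃ v₂ ∈ P₂.carrier, PShuf v v₂ u := Iff.rfl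

end AProc

/-! ## The processes form a model -/

theorem Proc.isLProcModel [DecidableEq V] : IsLProcModel (Proc.str V) where
  continuous_update l n := Proc.ωScottContinuous_of_mem
    (fun P Q h => Proc.le_of_steps (fun _ _ _ k => h k) (fun _ _ _ k => h k)) fun c r hr => by
      cases r with
      | nil => exact ⟨0, Proc.nil_mem _⟩
      | step s t u => exact Proc.mem_ωSup.1 hr
      | ret s t u => exact Proc.mem_ωSup.1 hr
  continuous_lookup l := Proc.ωScottContinuous_of_mem
    (fun P Q h => Proc.le_of_steps
      (fun s _ _ k => Proc.step_mem_lookup.2 (h (s l) (Proc.step_mem_lookup.1 k)))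
      (fun s _ _ k => Proc.ret_mem_lookup.2 (h (s l) (Proc.ret_mem_lookup.1 k)))) fun c r hr => by
      cases r with
      | nil => exact ⟨0, Proc.nil_mem _⟩
      | step s t u =>
        obtain ⟨i, hi⟩ := Proc.mem_ωSup.1 (Proc.step_mem_lookup.1 hr)
        exact ⟨i, Proc.step_mem_lookup.2 hi⟩
      | ret s t u =>
        obtain ⟨i, hi⟩ := Proc.mem_ωSup.1 (Proc.ret_mem_lookup.1 hr)
        exact ⟨i, Proc.ret_mem_lookup.2 hi⟩
  continuous_union := Proc.ωScottContinuous_of_mem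
    (fun P Q h => Set.union_subset_union h.1 h.2) fun c r hr => by
      rcases hr with hr | hr
      · obtain ⟨i, hi⟩ := Proc.mem_ωSup.1 hr
        exact ⟨i, .inl hi⟩
      · obtain ⟨i, hi⟩ := Proc.mem_ωSup.1 hr
        exact ⟨i, .inr hi⟩
  continuous_d := Proc.ωScottContinuous_of_mem
    (fun P Q h => Proc.le_of_steps
      (fun s _ _ k => Proc.step_mem_d.2 ((Proc.step_mem_d.1 k).imp_right fun k => h k))
      (fun s _ _ k => absurd k Proc.ret_notMem_d)) fun c r hr => by
      rcases hr with rfl | ⟨s, u, hu, rfl⟩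
      · exact ⟨0, Proc.nil_mem _⟩
      · obtain ⟨i, hi⟩ := Proc.mem_ωSup.1 hu
        exact ⟨i, .inr ⟨s, u, hi, rfl⟩⟩
  continuous_async := Proc.ωScottContinuous_of_mem
    (fun P Q h r ⟨u, hu, v, hv, hr⟩ => ⟨u, h.1 hu, v, h.2 hv, hr⟩) fun c r ⟨u, hu, v, hv, hr⟩ => by
      obtain ⟨i, hi⟩ := AProc.mem_ωSup.1 hu
      obtain ⟨j, hj⟩ := Proc.mem_ωSup.1 hv
      exact ⟨max i j, u, (c.monotone (le_max_left i j)).1 hi, v,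
        (c.monotone (le_max_right i j)).2 hj, hr⟩
  continuous_yieldTo := Proc.ωScottContinuous_of_mem
    (fun P Q h r ⟨u, hu, v, hv, hr⟩ => ⟨u, h.1 hu, v, h.2 hv, hr⟩) fun c r ⟨u, hu, v, hv, hr⟩ => by
      obtain ⟨i, hi⟩ := AProc.mem_ωSup.1 hu
      obtain ⟨j, hj⟩ := Proc.mem_ωSup.1 hv
      exact ⟨max i j, u, (c.monotone (le_max_left i j)).1 hi, v,
        (c.monotone (le_max_right i j)).2 hj, hr⟩
  lookup_update_self l x := by apply Proc.ext_steps <;> simp [str]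
  lookup_lookup_self l x := by apply Proc.ext_steps <;> simp [str]
  update_update_self l m n x := by apply Proc.ext_steps <;> simp [str]
  update_lookup_self l n x := by apply Proc.ext_steps <;> simp [str]
  lookup_lookup l k h x := by apply Proc.ext_steps <;> simp [str]
  update_update l k h m n x := by
    apply Proc.ext_steps <;> simp [str, Function.update_comm h]
  update_lookup l k h m x := by
    apply Proc.ext_steps <;> simp [str, Function.update_of_ne h.symm]
  union_assoc x y z := Proc.ext (Set.union_assoc _ _ _)
  union_comm x y := Proc.ext (Set.union_comm _ _)
  union_self x := Proc.ext (Set.union_self _)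
  le_union x y := Set.subset_union_left
  omega_le x := by rintro _ rfl; exact Proc.nil_mem x
  update_omega l n := by apply Proc.ext_steps <;> simp [str]
  lookup_omega l := by apply Proc.ext_steps <;> simp [str]
  update_union l n x y := by apply Proc.ext_steps <;> simp [str]
  lookup_union l x y := by apply Proc.ext_steps <;> simp [str]
  omega_union := Proc.ext (Set.union_self _)
  d_union x y := by apply Proc.ext_steps <;> simp [str, and_or_left]
  union_async P P₂ x := by
    apply Proc.ext_steps <;> simp [str, or_and_right, exists_or]
  async_union P x y := by
    apply Proc.ext_steps <;> simp [str, or_and_right, and_or_left, exists_or]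
  union_yieldTo P P₂ x := by
    apply Proc.ext_steps <;> simp [str, or_and_right, exists_or]
  yieldTo_union P x y := by
    apply Proc.ext_steps <;> simp [str, or_and_right, and_or_left, exists_or]
  async_update P l n x := by apply Proc.ext_steps <;> simp [str]
  async_lookup P l x := by apply Proc.ext_steps <;> simp [str]
  async_omega P := by apply Proc.ext_steps <;> simp [str]
  async_d P x := by
    apply Proc.ext_steps <;> intro s t u
    · change _ ↔ _ ∈ (Proc.d _).carrier
      rw [Proc.step_mem_d, Proc.mem_act]
      simp only [str, Proc.step_mem_async, Proc.step_mem_d]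
      grind
    · simp [str]
  async_async P P₂ x := by
    apply Proc.ext_steps <;> intro s t u
    · simp only [str, Proc.step_mem_async, AProc.mem_shuffle]
      constructor
      · rintro ⟨u₁, h₁, w₁, ⟨u₂, h₂, v, hv, k⟩, h⟩
        obtain ⟨u', hu', h'⟩ := h.assoc_left k
        exact ⟨u', ⟨u₁, h₁, u₂, h₂, hu'⟩, v, hv, h'⟩
      · rintro ⟨u', ⟨u₁, h₁, u₂, h₂, hu'⟩, v, hv, h'⟩
        obtain ⟨w₁, k, h⟩ := h'.assoc_right hu'
        exact ⟨u₁, h₁, w₁, ⟨u₂, h₂, v, hv, k⟩, h⟩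
    · simp only [str, Proc.ret_mem_async, AProc.mem_shuffle]
      constructor
      · rintro ⟨u₁, h₁, w₁, ⟨u₂, h₂, v, hv, k⟩, h⟩
        obtain ⟨u', hu', h'⟩ := h.assoc_left k
        exact ⟨u', ⟨u₁, h₁, u₂, h₂, hu'⟩, v, hv, h'⟩
      · rintro ⟨u', ⟨u₁, h₁, u₂, h₂, hu'⟩, v, hv, h'⟩
        obtain ⟨w₁, k, h⟩ := h'.assoc_right hu'
        exact ⟨u₁, h₁, w₁, ⟨u₂, h₂, v, hv, k⟩, h⟩
  update_yieldTo P l n x := by apply Proc.ext_steps <;> simp [str]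
  lookup_yieldTo P l x := by apply Proc.ext_steps <;> simp [str]
  omega_yieldTo x := by apply Proc.ext_steps <;> simp [str]
  d_yieldTo P x := by
    apply Proc.ext_steps <;> intro s t u
    · change _ ↔ _ ∈ (Proc.d _).carrier
      rw [Proc.step_mem_d, Proc.mem_act]
      simp only [str, Proc.step_mem_yieldTo, AProc.step_mem_d]
      grind
    · simp [str]
  halt_yieldTo x := by
    apply Proc.ext_steps <;> intro s t u
    · simp only [str, Proc.step_mem_yieldTo, AProc.step_mem_halt, Proc.step_mem_d]
      constructor
      · rintro ⟨v, ⟨rfl, hv⟩, v₂, hv₂, h⟩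
        refine ⟨rfl, ?_⟩
        -- Prefixes of `Done` are the empty sequence, which gives a prefix of `v₂`, and `Done`
        -- itself, which gives `v₂` exactly.
        cases hv with
        | nil => exact x.prefixClosed h.le_of_nil hv₂
        | done => rwa [TShuf.done_left_iff.1 h]
      · rintro ⟨rfl, hu⟩
        exact ⟨.done, ⟨rfl, le_rfl⟩, u, hu, TShuf.done_left_iff.2 rfl⟩
    · simp [str]
  omega_async_le x := by
    apply Proc.le_of_steps <;> intro s t u
    · simp only [str, Proc.step_mem_async, AProc.mem_omega]
      rintro ⟨_, rfl, v, hv, h⟩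
      exact x.prefixClosed (.step s t h.le_of_nil) hv
    · simp only [str, Proc.ret_mem_async, AProc.mem_omega]
      rintro ⟨_, rfl, v, hv, h⟩
      exact x.prefixClosed (.ret s t h.le_of_nil) hv

end CoopThreads

namespace CoopThreads

/-! ## Transfer of models along isomorphisms -/

theorem _root_.OrderIso.ωScottContinuous {A B : Type*} [OmegaCompletePartialOrder A]
    [OmegaCompletePartialOrder B] (e : A ≃o B) :
    OmegaCompletePartialOrder.ωScottContinuous e :=
  fun _ _ _ _ _ h => e.isLUB_image'.2 h

theorem IsLProcHom.symm {V A B : Type*} [OmegaCompletePartialOrder A]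
    [OmegaCompletePartialOrder B] {M : LProcStr V A} {N : LProcStr V B} {e : A ≃o B}
    (h : IsLProcHom M N e) : IsLProcHom N M e.symm where
  continuous := e.symm.ωScottContinuous
  map_update l n x := by simp [OrderIso.symm_apply_eq, h.map_update]
  map_lookup l x := by simp [OrderIso.symm_apply_eq, h.map_lookup]
  map_union x y := by simp [OrderIso.symm_apply_eq, h.map_union]
  map_omega := by simp [OrderIso.symm_apply_eq, h.map_omega]
  map_d x := by simp [OrderIso.symm_apply_eq, h.map_d]
  map_async P x := by simp [OrderIso.symm_apply_eq, h.map_async]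
  map_yieldTo P x := by simp [OrderIso.symm_apply_eq, h.map_yieldTo]

theorem IsLProcHom.map_act {V A B : Type*} [OmegaCompletePartialOrder A]
    [OmegaCompletePartialOrder B] {M : LProcStr V A} {N : LProcStr V B} {h : A → B}
    (hh : IsLProcHom M N h) (P : AProc V) (x : A) : h (M.act P x) = N.act P (h x) := by
  simp only [LProcStr.act, hh.map_union, hh.map_async, hh.map_yieldTo]

/-- Every operation of `M` is the conjugate by `e` of one of `N`, hence continuous. Equations are
tested after applying the injective map `e`, inequations because `e` reflects the order. -/
theorem IsLProcModel.of_orderIso {V A B : Type*} [DecidableEq V] [OmegaCompletePartialOrder A]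
    [OmegaCompletePartialOrder B] {M : LProcStr V A} {N : LProcStr V B} {e : A ≃o B}
    (h : IsLProcHom M N e) (hN : IsLProcModel N) : IsLProcModel M where
  continuous_update l n := by
    have := e.symm.ωScottContinuous.comp ((hN.continuous_update l n).comp e.ωScottContinuous)
    convert this using 1
    funext x
    simp [← h.map_update]
  continuous_lookup l := by
    have he : ωScottContinuous fun (x : ℕ → A) n => e (x n) :=
      ωScottContinuous.of_apply₂ fun n =>
        e.ωScottContinuous.comp (ωScottContinuous.apply (β := fun _ : ℕ => A) n)
    have := e.symm.ωScottContinuous.comp ((hN.continuous_lookup l).comp he)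
    convert this using 1
    funext x
    simp [← h.map_lookup]
  continuous_union := by
    have he : ωScottContinuous fun (x : A × A) => (e x.1, e x.2) :=
      Prod.ωScottContinuous.prodMk (e.ωScottContinuous.comp Prod.ωScottContinuous_fst)
        (e.ωScottContinuous.comp Prod.ωScottContinuous_snd)
    have := e.symm.ωScottContinuous.comp (hN.continuous_union.comp he)
    convert this using 1
    funext x
    simp [← h.map_union]
  continuous_d := by
    have := e.symm.ωScottContinuous.comp (hN.continuous_d.comp e.ωScottContinuous)
    convert this using 1
    funext x
    simp [← h.map_d]
  continuous_async := by
    have he : ωScottContinuous fun (x : AProc V × A) => (x.1, e x.2) :=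
      Prod.ωScottContinuous.prodMk Prod.ωScottContinuous_fst
        (e.ωScottContinuous.comp Prod.ωScottContinuous_snd)
    have := e.symm.ωScottContinuous.comp (hN.continuous_async.comp he)
    convert this using 1
    funext x
    simp [← h.map_async]
  continuous_yieldTo := by
    have he : ωScottContinuous fun (x : AProc V × A) => (x.1, e x.2) :=
      Prod.ωScottContinuous.prodMk Prod.ωScottContinuous_fst
        (e.ωScottContinuous.comp Prod.ωScottContinuous_snd)
    have := e.symm.ωScottContinuous.comp (hN.continuous_yieldTo.comp he)
    convert this using 1
    funext x
    simp [← h.map_yieldTo]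
  lookup_update_self l x := e.injective <| by
    simp only [h.map_lookup, h.map_update, hN.lookup_update_self]
  lookup_lookup_self l x := e.injective <| by
    simp only [h.map_lookup, hN.lookup_lookup_self]
  update_update_self l m n x := e.injective <| by
    simp only [h.map_update, hN.update_update_self]
  update_lookup_self l n x := e.injective <| by
    simp only [h.map_update, h.map_lookup, hN.update_lookup_self]
  lookup_lookup l k hl x := e.injective <| by
    simp only [h.map_lookup, hN.lookup_lookup l k hl]
  update_update l k hl m n x := e.injective <| by
    simp only [h.map_update, hN.update_update l k hl m n]
  update_lookup l k hl m x := e.injective <| by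
    simp only [h.map_update, h.map_lookup, hN.update_lookup l k hl]
  union_assoc x y z := e.injective <| by simp only [h.map_union, hN.union_assoc]
  union_comm x y := e.injective <| by simp only [h.map_union, hN.union_comm (e x)]
  union_self x := e.injective <| by simp only [h.map_union, hN.union_self]
  le_union x y := e.le_iff_le.1 <| by simpa only [h.map_union] using hN.le_union _ _
  omega_le x := e.le_iff_le.1 <| by simpa only [h.map_omega] using hN.omega_le _
  update_omega l n := e.injective <| by simp only [h.map_update, h.map_omega, hN.update_omega]
  lookup_omega l := e.injective <| by simp only [h.map_lookup, h.map_omega, hN.lookup_omega]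
  update_union l n x y := e.injective <| by simp only [h.map_update, h.map_union, hN.update_union]
  lookup_union l x y := e.injective <| by simp only [h.map_lookup, h.map_union, hN.lookup_union]
  omega_union := e.injective <| by simp only [h.map_union, hN.union_self]
  d_union x y := e.injective <| by simp only [h.map_d, h.map_union, hN.d_union]
  union_async P P₂ x := e.injective <| by simp only [h.map_async, h.map_union, hN.union_async]
  async_union P x y := e.injective <| by simp only [h.map_async, h.map_union, hN.async_union]
  union_yieldTo P P₂ x := e.injective <| by
    simp only [h.map_yieldTo, h.map_union, hN.union_yieldTo]
  yieldTo_union P x y := e.injective <| by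
    simp only [h.map_yieldTo, h.map_union, hN.yieldTo_union]
  async_update P l n x := e.injective <| by simp only [h.map_async, h.map_update, hN.async_update]
  async_lookup P l x := e.injective <| by simp only [h.map_async, h.map_lookup, hN.async_lookup]
  async_omega P := e.injective <| by simp only [h.map_async, h.map_omega, hN.async_omega]
  async_d P x := e.injective <| by simp only [h.map_async, h.map_d, h.map_act, hN.async_d]
  async_async P P₂ x := e.injective <| by simp only [h.map_async, hN.async_async]
  update_yieldTo P l n x := e.injective <| by
    simp only [h.map_yieldTo, h.map_update, hN.update_yieldTo]
  lookup_yieldTo P l x := e.injective <| by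
    simp only [h.map_yieldTo, h.map_lookup, hN.lookup_yieldTo]
  omega_yieldTo x := e.injective <| by
    simp only [h.map_yieldTo, h.map_omega, hN.omega_yieldTo]
  d_yieldTo P x := e.injective <| by simp only [h.map_yieldTo, h.map_d, h.map_act, hN.d_yieldTo]
  halt_yieldTo x := e.injective <| by simp only [h.map_yieldTo, h.map_d, hN.halt_yieldTo]
  omega_async_le x := e.le_iff_le.1 <| by simpa only [h.map_async] using hN.omega_async_le _

/-! ## The isomorphism between ideals and processes -/

variable {V : Type*}

theorem theta_ne_nil (v : QTrans V RetPoint) : theta v ≠ .nil := by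
  rcases v with _ | ⟨_, _, ⟨⟨⟩, _⟩⟩ | _ <;> simp [theta]

theorem exists_theta_eq {r : TSeq V} (h : r ≠ .nil) : ∃ v, theta v = r := by
  induction r with
  | nil => exact absurd rfl h
  | step s t r ih =>
    by_cases hr : r = .nil
    · exact ⟨.last s t, by rw [hr, theta]⟩
    · obtain ⟨v, rfl⟩ := ih hr
      exact ⟨.step s t v, rfl⟩
  | ret s t u => exact ⟨.lastRet s t (.Ret, u), rfl⟩

/-- A final plain transition becomes a transition followed by the empty sequence, so extending it is
a prefix step, and enlarging the mark of a return becomes extending what follows the return. Since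
`theta` never yields the empty sequence, no further comparisons arise. -/
theorem theta_le_theta {u v : QTrans V RetPoint} : theta u ≤ theta v ↔ u ≤ v := by
  constructor
  · intro h
    induction u generalizing v with
    | last s t =>
      rcases v with _ | ⟨_, _, ⟨⟨⟩, _⟩⟩ | _ <;> cases h
      · exact .last s t
      · exact .last_step s t _
    | lastRet s t x =>
      obtain ⟨⟨⟩, x⟩ := x
      rcases v with _ | ⟨_, _, ⟨⟨⟩, _⟩⟩ | _ <;> cases h
      exact .lastRet s t ⟨trivial, by assumption⟩
    | step s t u ih =>
      rcases v with _ | ⟨_, _, ⟨⟨⟩, _⟩⟩ | ⟨_, _, v⟩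
      · cases h with | step _ _ h => cases u with
        | lastRet _ _ x => obtain ⟨⟨⟩, x⟩ := x; cases h
        | _ => cases h
      · cases h
      · cases h with | step _ _ h => exact .step s t (ih h)
  · intro h
    induction h with
    | last s t => exact le_rfl
    | last_step s t u => exact .step s t (.nil _)
    | @lastRet s t x y h =>
      obtain ⟨⟨⟩, x⟩ := x
      obtain ⟨⟨⟩, y⟩ := y
      exact .ret s t h.2
    | step s t h ih => exact .step s t ih

theorem theta_injective : Function.Injective (theta (V := V)) := fun _ _ h =>
  le_antisymm (theta_le_theta.1 h.le) (theta_le_theta.1 h.ge)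

theorem theta_mem_thetaTilde {v : QTrans V RetPoint} {I : Iomega (QTrans V RetPoint)} :
    theta v ∈ (thetaTilde I).carrier ↔ v ∈ I.carrier := by
  constructor
  · rintro (⟨u, hu, h⟩ | h)
    · rwa [← theta_injective h]
    · exact absurd h (theta_ne_nil v)
  · exact fun h => .inl ⟨v, h, rfl⟩

theorem Proc.ext_theta {P Q : Proc V}
    (h : ∀ v, theta v ∈ P.carrier ↔ theta v ∈ Q.carrier) : P = Q := by
  ext r
  by_cases hr : r = .nil
  · simp [hr, nil_mem]
  · obtain ⟨v, rfl⟩ := exists_theta_eq hr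
    exact h v

/-- `thetaTilde` as an isomorphism of posets. -/
def thetaTildeIso (V : Type*) [Finite V] : Iomega (QTrans V RetPoint) ≃o Proc V where
  toFun := thetaTilde
  invFun P := .ofLower {v | theta v ∈ P.carrier} fun _ _ h hv =>
    P.prefixClosed (theta_le_theta.2 h) hv
  left_inv I := Iomega.ext (Set.ext fun _ => theta_mem_thetaTilde)
  right_inv P := Proc.ext_theta fun _ => theta_mem_thetaTilde
  map_rel_iff' {I J} := by
    constructor
    · exact fun h v hv => theta_mem_thetaTilde.1 (h (theta_mem_thetaTilde.2 hv))
    · rintro h _ (⟨v, hv, rfl⟩ | rfl)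
      · exact .inl ⟨v, h hv, rfl⟩
      · exact .inr rfl

-- Incomplete shuffles compared with shuffles

/-- Shuffling with an empty main thread only erases `Done`. The leading transition is there because
`BTrans.ofPure` must return a non-empty sequence, even if nothing of `u` remains. -/
theorem tShuf_nil_right_iff {u : PSeq V} {w : TSeq V} (s t : Store V) :
    TShuf u .nil w ↔ TSeq.step s t w = theta (BTrans.ofPure s t u) := by
  induction u generalizing s t w with
  | nil =>
    simp only [BTrans.ofPure, theta, TSeq.step.injEq, true_and]
    exact ⟨fun h => by cases h; rfl, by rintro rfl; exact .nil_nil⟩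
  | done =>
    simp only [BTrans.ofPure, theta, TSeq.step.injEq, true_and]
    exact ⟨fun h => by cases h; rfl, by rintro rfl; exact .done_nil⟩
  | step s₂ t₂ u ih =>
    simp only [BTrans.ofPure, theta, TSeq.step.injEq, true_and]
    constructor
    · intro h
      cases h with | left _ _ h => exact (ih _ _).1 h
    · intro h
      -- Whatever `u` is, the sequence made from it by `BTrans.ofPure` starts with the transition
      -- from `s₂` to `t₂`.
      have hw : ∃ w₂, w = .step s₂ t₂ w₂ := by
        cases u <;> exact ⟨_, h⟩
      obtain ⟨w₂, rfl⟩ := hw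
      exact .left _ _ ((ih _ _).2 h)

theorem TShuf.ne_nil {u : PSeq V} {v w : TSeq V} (h : TShuf u v w) (hv : v ≠ .nil) : w ≠ .nil := by
  cases h <;> simp_all

/-- A shuffle splits according to whose transition comes first. The value `{ε}` of a left shuffle
with empty `u` is harmless, as no `theta r` is a prefix of the empty sequence. -/
theorem mem_incLeft_or_mem_incRight {u : PSeq V} {v : QTrans V RetPoint}
    (hR : ∀ r, r ∈ incRight u v ↔ ∃ w ∈ rightShuffle u (theta v), theta r ≤ w)
    (hL : ∀ r, r ∈ incLeft u v ↔ ∃ w ∈ leftShuffle u (theta v), theta r ≤ w)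
    (r : QTrans V RetPoint) :
    r ∈ incLeft u v ∨ r ∈ incRight u v ↔ ∃ w, TShuf u (theta v) w ∧ theta r ≤ w := by
  rw [hL, hR]
  constructor
  · rintro (⟨w, hw, h⟩ | ⟨w, hw, h⟩)
    · cases u with
      | nil =>
        cases hw
        generalize hx : theta r = x at h
        cases h
        exact absurd hx (theta_ne_nil r)
      | done => cases hw
      | step s t u => obtain ⟨w, hw, rfl⟩ := hw; exact ⟨_, .left s t hw, h⟩
    · generalize hx : theta v = x at hw ⊢
      cases x with
      | nil => exact absurd hx (theta_ne_nil v)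
      | step => obtain ⟨w, hw, rfl⟩ := hw; exact ⟨_, .right _ _ hw, h⟩
      | ret => obtain ⟨w, hw, rfl⟩ := hw; exact ⟨_, .left_ret _ _ hw, h⟩
  · rintro ⟨w, hw, h⟩
    generalize hx : theta v = x at hw ⊢
    cases hw with
    | nil_nil => exact absurd hx (theta_ne_nil v)
    | done_nil => exact absurd hx (theta_ne_nil v)
    | left s t hw => exact .inl ⟨_, ⟨_, hw, rfl⟩, h⟩
    | right s t hw => exact .inr ⟨_, ⟨_, hw, rfl⟩, h⟩
    | left_ret s t hw => exact .inr ⟨_, ⟨_, hw, rfl⟩, h⟩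

/-- Since `theta v` is non-empty, so is every shuffle with it. Such a shuffle is therefore in the
image of `theta`, which supplies the generator of the lower closure. -/
theorem mem_lowerClosure_step_iff {u : PSeq V} {v : QTrans V RetPoint} {s t : Store V}
    {p : QTrans V RetPoint → Prop}
    (hp : ∀ r, p r ↔ ∃ w, TShuf u (theta v) w ∧ theta r ≤ w) (r : QTrans V RetPoint) :
    r ∈ lowerClosure {r | ∃ w, p w ∧ r = BTrans.step s t w} ↔
      ∃ w, (∃ w₂, TShuf u (theta v) w₂ ∧ w = .step s t w₂) ∧ theta r ≤ w := by
  rw [mem_lowerClosure]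
  constructor
  · rintro ⟨_, ⟨w, hw, rfl⟩, h⟩
    obtain ⟨w₂, hw₂, hle⟩ := (hp w).1 hw
    exact ⟨_, ⟨w₂, hw₂, rfl⟩, (theta_le_theta.2 h).trans (.step s t hle)⟩
  · rintro ⟨_, ⟨w₂, hw₂, rfl⟩, h⟩
    obtain ⟨w, rfl⟩ := exists_theta_eq (hw₂.ne_nil (theta_ne_nil v))
    exact ⟨_, ⟨w, (hp w).2 ⟨_, hw₂, le_rfl⟩, rfl⟩, theta_le_theta.1 h⟩

/-- The mutual recursion is untangled into nested inductions: a left shuffle shortens `u` and keeps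
`v`, so for fixed `v` an induction on `u` suffices once the right shuffles with `v` are known for
all proper `u`. -/
theorem mem_incLeft_of_mem_incRight {v : QTrans V RetPoint}
    (hR : ∀ u : PSeq V, u ≠ .done → ∀ r,
      r ∈ incRight u v ↔ ∃ w ∈ rightShuffle u (theta v), theta r ≤ w)
    {u : PSeq V} (hu : u ≠ .done) (r : QTrans V RetPoint) :
    r ∈ incLeft u v ↔ ∃ w ∈ leftShuffle u (theta v), theta r ≤ w := by
  induction u generalizing r with
  | nil =>
    rw [incLeft]
    simp only [LowerSet.notMem_bot, leftShuffle, Set.mem_singleton_iff, exists_eq_left, false_iff]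
    intro h
    generalize hx : theta r = x at h
    cases h
    exact theta_ne_nil r hx
  | done => exact absurd rfl hu
  | step s t u ih =>
    -- A remainder `Done` is no proper sequence, and `incLeft` has its own clause for it; there the
    -- neutrality of `Done` replaces the induction hypothesis.
    by_cases hd : u = .done
    · subst hd
      rw [incLeft, mem_lowerClosure]
      simp only [leftShuffle, TShuf.done_left_iff]
      constructor
      · rintro ⟨_, rfl, h⟩
        exact ⟨_, ⟨_, rfl, rfl⟩, theta_le_theta.2 h⟩
      · rintro ⟨_, ⟨_, rfl, rfl⟩, h⟩
        exact ⟨_, rfl, theta_le_theta.1 h⟩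
    · rw [incLeft.eq_4 _ _ _ _ hd]
      exact mem_lowerClosure_step_iff (mem_incLeft_or_mem_incRight (hR u hd) (ih hd)) r

/-- This is the outer induction, on `v`, with `u` arbitrary, because the left shuffles with the
shorter `v` call for right shuffles with other `u`. -/
theorem mem_incRight {v : QTrans V RetPoint} {u : PSeq V} (hu : u ≠ .done)
    (r : QTrans V RetPoint) :
    r ∈ incRight u v ↔ ∃ w ∈ rightShuffle u (theta v), theta r ≤ w := by
  induction v generalizing u r with
  | last s t =>
    rw [incRight, mem_lowerClosure]
    simp only [theta, rightShuffle, tShuf_nil_right_iff s t]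
    constructor
    · rintro ⟨_, rfl, h⟩
      obtain ⟨w, hw⟩ : ∃ w, TSeq.step s t w = theta (BTrans.ofPure s t u) := by
        cases u <;> exact ⟨_, rfl⟩
      exact ⟨_, ⟨w, hw, rfl⟩, hw ▸ theta_le_theta.2 h⟩
    · rintro ⟨_, ⟨w, hw, rfl⟩, h⟩
      exact ⟨_, rfl, theta_le_theta.1 (hw ▸ h)⟩
  | lastRet s t x =>
    obtain ⟨⟨⟩, x⟩ := x
    rw [incRight, mem_lowerClosure]
    constructor
    · rintro ⟨_, ⟨w, hw, rfl⟩, h⟩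
      exact ⟨_, ⟨w, hw, rfl⟩, theta_le_theta.2 h⟩
    · rintro ⟨_, ⟨w, hw, rfl⟩, h⟩
      exact ⟨_, ⟨w, hw, rfl⟩, theta_le_theta.1 h⟩
  | step s t v ih =>
    rw [incRight]
    exact mem_lowerClosure_step_iff (mem_incLeft_or_mem_incRight (ih hu)
      (mem_incLeft_of_mem_incRight (fun u hu => ih hu) hu)) r

theorem mem_incLeft {v : QTrans V RetPoint} {u : PSeq V} (hu : u ≠ .done)
    (r : QTrans V RetPoint) :
    r ∈ incLeft u v ↔ ∃ w ∈ leftShuffle u (theta v), theta r ≤ w :=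
  mem_incLeft_of_mem_incRight (fun _ hu => mem_incRight hu) hu r

theorem AProc.ne_done {P : AProc V} {u : PSeq V} (hu : u ∈ P.carrier) : u ≠ .done := by
  rintro rfl
  exact P.proper hu

theorem isLProcHom_thetaTilde [Finite V] [DecidableEq V] :
    IsLProcHom (Iomega.str V RetPoint) (Proc.str V) (thetaTildeIso V) where
  continuous := (thetaTildeIso V).ωScottContinuous
  map_update l n I := Proc.ext_theta fun r => by
    refine theta_mem_thetaTilde.trans ?_
    rcases r with ⟨s, t⟩ | ⟨s, t, ⟨⟨⟩, w⟩⟩ | ⟨s, t, u⟩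
    · exact (theta_mem_thetaTilde (v := .last (Function.update s l n) t)).symm
    · exact (theta_mem_thetaTilde (v := .lastRet (Function.update s l n) t (.Ret, w))).symm
    · exact (theta_mem_thetaTilde (v := .step (Function.update s l n) t u)).symm
  map_lookup l I := Proc.ext_theta fun r => by
    refine theta_mem_thetaTilde.trans ?_
    rcases r with ⟨s, t⟩ | ⟨s, t, ⟨⟨⟩, w⟩⟩ | ⟨s, t, u⟩
    · refine Iff.trans ?_ ((theta_mem_thetaTilde (v := .last s t) (I := I (s l))).symm.trans
        (Proc.step_mem_lookup (R := fun n => thetaTilde (I n))).symm)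
      exact ⟨by rintro ⟨_, h, rfl⟩; exact h, fun h => ⟨_, h, rfl⟩⟩
    · refine Iff.trans ?_ ((theta_mem_thetaTilde (v := .lastRet s t (.Ret, w))
        (I := I (s l))).symm.trans (Proc.ret_mem_lookup (R := fun n => thetaTilde (I n))).symm)
      exact ⟨by rintro ⟨_, h, rfl⟩; exact h, fun h => ⟨_, h, rfl⟩⟩
    · refine Iff.trans ?_ ((theta_mem_thetaTilde (v := .step s t u) (I := I (s l))).symm.trans
        (Proc.step_mem_lookup (R := fun n => thetaTilde (I n))).symm)
      exact ⟨by rintro ⟨_, h, rfl⟩; exact h, fun h => ⟨_, h, rfl⟩⟩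
  map_union I J := Proc.ext_theta fun r =>
    theta_mem_thetaTilde.trans
      (or_congr theta_mem_thetaTilde.symm theta_mem_thetaTilde.symm)
  map_omega := Proc.ext_theta fun r => theta_mem_thetaTilde.trans
    ⟨fun h => h.elim, fun h => absurd h (theta_ne_nil r)⟩
  map_d I := Proc.ext_theta fun r => by
    refine theta_mem_thetaTilde.trans ?_
    rcases r with ⟨s, t⟩ | ⟨s, t, ⟨⟨⟩, w⟩⟩ | ⟨s, t, u⟩
    -- The separate sequences `(s, s)` in `d` of an ideal account for the empty sequence, which
    -- belongs to the process but is absent from the ideal.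
    · refine Iff.trans ?_ Proc.step_mem_d.symm
      constructor
      · rintro (⟨_, _, _, ⟨⟩⟩ | ⟨_, ⟨⟩⟩)
        exact ⟨rfl, Proc.nil_mem _⟩
      · rintro ⟨rfl, _⟩
        exact .inr ⟨_, rfl⟩
    · refine iff_of_false ?_ Proc.ret_notMem_d
      rintro (⟨_, _, _, ⟨⟩⟩ | ⟨_, ⟨⟩⟩)
    · refine Iff.trans ?_ Proc.step_mem_d.symm
      constructor
      · rintro (⟨_, _, h, ⟨⟩⟩ | ⟨_, ⟨⟩⟩)
        exact ⟨rfl, theta_mem_thetaTilde.2 h⟩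
      · rintro ⟨rfl, h⟩
        exact .inl ⟨_, _, theta_mem_thetaTilde.1 h, rfl⟩
  map_async P I := Proc.ext_theta fun r => by
    refine theta_mem_thetaTilde.trans ?_
    constructor
    · rintro ⟨u, hu, v, hv, hr⟩
      obtain ⟨w, hw, h⟩ := (mem_incRight (P.ne_done hu) r).1 hr
      exact Proc.prefixClosed _ h ⟨u, hu, _, theta_mem_thetaTilde.2 hv, hw⟩
    · rintro ⟨u, hu, _, ⟨v, hv, rfl⟩ | rfl, hr⟩
      · exact ⟨u, hu, v, hv, (mem_incRight (P.ne_done hu) r).2 ⟨_, hr, le_rfl⟩⟩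
      · exact absurd hr (theta_ne_nil r)
  map_yieldTo P I := Proc.ext_theta fun r => by
    refine theta_mem_thetaTilde.trans ?_
    constructor
    · rintro (⟨u, hu, v, hv, hr⟩ | ⟨s, t, u, hu, rfl⟩)
      · obtain ⟨w, hw, h⟩ := (mem_incLeft (P.ne_done hu) r).1 hr
        exact Proc.prefixClosed _ h ⟨u, hu, _, theta_mem_thetaTilde.2 hv, hw⟩
      -- The extra sequences `u⁻` are the left shuffles of `u` with the empty sequence of the
      -- process.
      · obtain ⟨w, hw⟩ : ∃ w, TSeq.step s t w = theta (BTrans.ofPure s t u) := by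
          cases u <;> exact ⟨_, rfl⟩
        exact ⟨_, hu, _, Proc.nil_mem _, w, (tShuf_nil_right_iff s t).2 hw, hw.symm⟩
    · rintro ⟨u, hu, _, ⟨v, hv, rfl⟩ | rfl, hr⟩
      · exact .inl ⟨u, hu, v, hv, (mem_incLeft (P.ne_done hu) r).2 ⟨_, hr, le_rfl⟩⟩
      · cases u with
        | nil => exact absurd hr (theta_ne_nil r)
        | done => exact absurd hu P.proper
        | step s t u =>
          obtain ⟨w, hw, hr⟩ := hr
          exact .inr ⟨s, t, u, hu, theta_injective (hr.trans ((tShuf_nil_right_iff s t).1 hw))⟩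

theorem isLProcIso_thetaTilde [Finite V] [DecidableEq V] :
    IsLProcIso (Iomega.str V RetPoint) (Proc.str V) thetaTilde :=
  ⟨isLProcHom_thetaTilde, (thetaTildeIso V).symm, isLProcHom_thetaTilde.symm,
    (thetaTildeIso V).symm_apply_apply, (thetaTildeIso V).apply_symm_apply⟩

end CoopThreads

namespace CoopThreads

/-! ## Countable suprema -/

/-- `F` preserves all existing suprema of countable non-empty sets. -/
def PreservesCountableSups {A B : Type*} [Preorder A] [Preorder B] (F : A → B) : Prop :=
  ∀ ⦃S : Set A⦄, S.Countable → S.Nonempty → ∀ ⦃x : A⦄, IsLUB S x → IsLUB (F '' S) (F x)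

theorem PreservesCountableSups.comp {A B C : Type*} [Preorder A] [Preorder B] [Preorder C]
    {G : B → C} {F : A → B} (hG : PreservesCountableSups G) (hF : PreservesCountableSups F) :
    PreservesCountableSups fun x => G (F x) := by
  intro S hS hne x hx
  have := hG (hS.image F) (hne.image F) (hF hS hne hx)
  rwa [Set.image_image] at this

/-- The chain consists of the joins of initial segments of an enumeration of `S`. The property `p`
is kept general so that it can later express a bound on elements as well as a bound on their images.
-/
theorem exists_chain_of_countable {A : Type*} [OmegaCompletePartialOrder A]
    (hA : ∀ x y : A, ∃ z, IsLUB {x, y} z) {S : Set A} (hS : S.Countable) (hne : S.Nonempty) :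
    ∃ c : Chain A, (∀ x ∈ S, ∃ n, x ≤ c n) ∧ ∀ p : A → Prop, (∀ x ∈ S, p x) →
      (∀ x y z, IsLUB {x, y} z → p x → p y → p z) → ∀ n, p (c n) := by
  choose j hj using hA
  obtain ⟨e, rfl⟩ := hS.exists_eq_range hne
  let f : ℕ → A := fun n => Nat.rec (e 0) (fun n x => j x (e (n + 1))) n
  refine ⟨⟨f, monotone_nat_of_le_succ fun n => (hj _ _).1 (.inl rfl)⟩, ?_, fun p hp hu n => ?_⟩
  · rintro _ ⟨n, rfl⟩
    refine ⟨n, ?_⟩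
    cases n with
    | zero => exact le_rfl
    | succ n => exact (hj (f n) (e (n + 1))).1 (by simp)
  · induction n with
    | zero => exact hp _ ⟨0, rfl⟩
    | succ n ih => exact hu _ _ _ (hj _ _) ih (hp _ ⟨n + 1, rfl⟩)

theorem exists_isLUB_of_countable {A : Type*} [OmegaCompletePartialOrder A]
    (hA : ∀ x y : A, ∃ z, IsLUB {x, y} z) {S : Set A} (hS : S.Countable) (hne : S.Nonempty) :
    ∃ x, IsLUB S x := by
  obtain ⟨c, hc, hp⟩ := exists_chain_of_countable hA hS hne
  refine ⟨ωSup c, fun x hx => ?_, fun b hb => ωSup_le _ _ fun n =>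
    hp (· ≤ b) (fun x hx => hb hx) (fun x y z hz h₁ h₂ => hz.2 ?_) n⟩
  · obtain ⟨n, hn⟩ := hc x hx
    exact hn.trans (le_ωSup c n)
  · rintro _ (rfl | rfl) <;> assumption

/-- A countable sup is the sup of a chain of finite joins: continuity handles the chain and `h` the
joins. -/
theorem PreservesCountableSups.of_pair {A B : Type*} [OmegaCompletePartialOrder A]
    [OmegaCompletePartialOrder B] {F : A → B} (hA : ∀ x y : A, ∃ z, IsLUB {x, y} z)
    (hF : ωScottContinuous F)
    (h : ∀ x y z, IsLUB {x, y} z → ∀ b, F x ≤ b → F y ≤ b → F z ≤ b) :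
    PreservesCountableSups F := by
  intro S hS hne x hx
  obtain ⟨c, hc, hp⟩ := exists_chain_of_countable hA hS hne
  have hxc : x ≤ ωSup c := hx.2 fun y hy => by
    obtain ⟨n, hn⟩ := hc y hy
    exact hn.trans (le_ωSup c n)
  refine ⟨?_, fun b hb => (hF.monotone hxc).trans ?_⟩
  · rintro _ ⟨y, hy, rfl⟩
    exact hF.monotone (hx.1 hy)
  · rw [hF.map_ωSup]
    exact ωSup_le _ _ fun n => hp (F · ≤ b) (fun y hy => hb ⟨y, hy, rfl⟩)
      (fun x y z hz h₁ h₂ => h x y z hz b h₁ h₂) n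

/-- If `x ≤ y`, then `y` is the sup of `{x, y}`. -/
theorem PreservesCountableSups.monotone {A B : Type*} [PartialOrder A] [PartialOrder B]
    {F : A → B} (hF : PreservesCountableSups F) : Monotone F := fun x y hxy =>
  (hF (S := {x, y}) (Set.toFinite _).countable ⟨x, by simp⟩
    ⟨by rintro _ (rfl | rfl); exacts [hxy, le_rfl], fun b hb => hb (by simp)⟩).1
    ⟨x, by simp, rfl⟩

theorem PreservesCountableSups.ωScottContinuous {A B : Type*} [OmegaCompletePartialOrder A]
    [OmegaCompletePartialOrder B] {F : A → B} (hF : PreservesCountableSups F) :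
    OmegaCompletePartialOrder.ωScottContinuous F := by
  refine ωScottContinuous.of_monotone_map_ωSup ⟨hF.monotone, fun c => ?_⟩
  have := hF (Set.countable_range c) (Set.range_nonempty _) (isLUB_range_ωSup c)
  rw [← Set.range_comp] at this
  exact this.unique (isLUB_range_ωSup (c.map ⟨F, hF.monotone⟩))

variable {V A B : Type*}

section

variable [DecidableEq V] [OmegaCompletePartialOrder A] [OmegaCompletePartialOrder B]
  {M : LProcStr V A} {N : LProcStr V B}

-- Joins in a model, and the operations that preserve them

namespace IsLProcModel

/-- The inequation and commutativity make the union an upper bound. It is the least one because it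
is monotone and idempotent. -/
theorem isLUB_union (hM : IsLProcModel M) (x y : A) : IsLUB {x, y} (M.union x y) := by
  constructor
  · rintro _ (rfl | rfl)
    · exact hM.le_union _ _
    · exact hM.union_comm _ _ ▸ hM.le_union _ _
  · intro b hb
    have : M.union x y ≤ M.union b b :=
      hM.continuous_union.monotone (show (x, y) ≤ (b, b) from ⟨hb (by simp), hb (by simp)⟩)
    rwa [hM.union_self] at this

theorem exists_isLUB (hM : IsLProcModel M) {S : Set A} (hS : S.Countable) (hne : S.Nonempty) :
    ∃ x, IsLUB S x :=
  exists_isLUB_of_countable (fun x y => ⟨_, hM.isLUB_union x y⟩) hS hne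

theorem preserves (hM : IsLProcModel M) (hN : IsLProcModel N) {F : A → B}
    (hF : ωScottContinuous F) (hU : ∀ x y, F (M.union x y) = N.union (F x) (F y)) :
    PreservesCountableSups F := by
  refine .of_pair (fun x y => ⟨_, hM.isLUB_union x y⟩) hF fun x y z hz b hx hy => ?_
  rw [hz.unique (hM.isLUB_union x y), hU]
  exact (hN.isLUB_union _ _).2 (by rintro _ (rfl | rfl) <;> assumption)

theorem preserves_aProc (hN : IsLProcModel N) {F : AProc V → B}
    (hF : ωScottContinuous F) (hU : ∀ P P₂, F (P.union P₂) = N.union (F P) (F P₂)) :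
    PreservesCountableSups F := by
  have hl : ∀ P P₂ : AProc V, IsLUB {P, P₂} (P.union P₂) := fun P P₂ => by
    constructor
    · rintro _ (rfl | rfl)
      · exact Set.subset_union_left
      · exact Set.subset_union_right
    · exact fun b hb => Set.union_subset (hb (by simp)) (hb (by simp))
  refine .of_pair (fun x y => ⟨_, hl x y⟩) hF fun x y z hz b hx hy => ?_
  rw [hz.unique (hl x y), hU]
  exact (hN.isLUB_union _ _).2 (by rintro _ (rfl | rfl) <;> assumption)

theorem preserves_update (hM : IsLProcModel M) (l : V) (n : ℕ) :
    PreservesCountableSups (M.update l n) :=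
  hM.preserves hM (hM.continuous_update l n) (hM.update_union l n)

theorem preserves_d (hM : IsLProcModel M) : PreservesCountableSups M.d :=
  hM.preserves hM hM.continuous_d hM.d_union

theorem preserves_async (hM : IsLProcModel M) (P : AProc V) :
    PreservesCountableSups (M.async P) :=
  hM.preserves hM (hM.continuous_async.comp
    (Prod.ωScottContinuous.prodMk (.const (x := P)) .id)) (hM.async_union P)

theorem preserves_async_left (hM : IsLProcModel M) (x : A) :
    PreservesCountableSups fun P => M.async P x :=
  hM.preserves_aProc (hM.continuous_async.comp
    (Prod.ωScottContinuous.prodMk .id (.const (x := x)))) fun P P₂ => hM.union_async P P₂ x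

theorem preserves_yieldTo_left (hM : IsLProcModel M) (x : A) :
    PreservesCountableSups fun P => M.yieldTo P x :=
  hM.preserves_aProc (hM.continuous_yieldTo.comp
    (Prod.ωScottContinuous.prodMk .id (.const (x := x)))) fun P P₂ => hM.union_yieldTo P P₂ x

end IsLProcModel

end

/-! ## Setting and testing the whole store -/

/-- Assign `t l` to every variable `l` in the list. -/
def updateList (upd : V → ℕ → A → A) (L : List V) (t : Store V) (x : A) : A :=
  L.foldr (fun l => upd l (t l)) x

/-- Continue with `x` if every variable `l` in the list has value `s l`. -/
def testList (lk : V → (ℕ → A) → A) (om : A) (L : List V) (s : Store V) (x : A) : A :=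
  L.foldr (fun l y => lk l fun n => if n = s l then y else om) x

/-- A list of all variables. -/
noncomputable def allVars (V : Type*) [Finite V] : List V :=
  (@Finset.univ V (Fintype.ofFinite V)).toList

theorem mem_allVars [Finite V] (l : V) : l ∈ allVars V := by
  simp [allVars]

theorem nodup_allVars [Finite V] : (allVars V).Nodup := Finset.nodup_toList _

/-- The transition from the store `s` to the store `t`, followed by `x`. -/
noncomputable def transition [Finite V] (upd : V → ℕ → A → A) (lk : V → (ℕ → A) → A) (om : A)
    (s t : Store V) (x : A) : A :=
  testList lk om (allVars V) s (updateList upd (allVars V) t x)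

theorem map_updateList {upd : V → ℕ → A → A} {upd' : V → ℕ → B → B} {h : A → B}
    (hu : ∀ l n x, h (upd l n x) = upd' l n (h x)) (L : List V) (t : Store V) (x : A) :
    h (updateList upd L t x) = updateList upd' L t (h x) := by
  induction L with
  | nil => rfl
  | cons l L ih => exact (hu _ _ _).trans (congrArg _ ih)

theorem map_testList {lk : V → (ℕ → A) → A} {lk' : V → (ℕ → B) → B} {om : A} {om' : B} {h : A → B}
    (hl : ∀ l x, h (lk l x) = lk' l (fun n => h (x n))) (ho : h om = om') (L : List V)
    (s : Store V) (x : A) :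
    h (testList lk om L s x) = testList lk' om' L s (h x) := by
  induction L with
  | nil => rfl
  | cons l L ih =>
    refine (hl _ _).trans (congrArg _ (funext fun n => ?_))
    rw [apply_ite h, ho]
    exact congrArg (fun y => if n = s l then y else om') ih

theorem map_transition [Finite V] {upd : V → ℕ → A → A} {upd' : V → ℕ → B → B}
    {lk : V → (ℕ → A) → A} {lk' : V → (ℕ → B) → B} {om : A} {om' : B} {h : A → B}
    (hu : ∀ l n x, h (upd l n x) = upd' l n (h x))
    (hl : ∀ l x, h (lk l x) = lk' l (fun n => h (x n))) (ho : h om = om') (s t : Store V) (x : A) :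
    h (transition upd lk om s t x) = transition upd' lk' om' s t (h x) := by
  rw [transition, map_testList hl ho, map_updateList hu, transition]

theorem updateList_congr {upd : V → ℕ → A → A} {L : List V} {t t' : Store V} {x : A}
    (h : ∀ l ∈ L, t l = t' l) : updateList upd L t x = updateList upd L t' x := by
  induction L with
  | nil => rfl
  | cons l L ih =>
    have h₁ := ih fun k hk => h k (List.mem_cons_of_mem _ hk)
    have h₂ := h l List.mem_cons_self
    simp only [updateList, List.foldr_cons] at h₁ ⊢
    rw [h₁, h₂]

-- Calculating with assignments and tests in a model

namespace IsLProcModel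

variable [DecidableEq V] [OmegaCompletePartialOrder A] {M : LProcStr V A}

theorem updateList_update_of_notMem (hM : IsLProcModel M) {L : List V} {l : V} (hl : l ∉ L)
    (n : ℕ) (t : Store V) (x : A) :
    updateList M.update L t (M.update l n x) = M.update l n (updateList M.update L t x) := by
  induction L with
  | nil => rfl
  | cons k L ih =>
    rw [List.mem_cons, not_or] at hl
    have h₁ := ih hl.2
    simp only [updateList, List.foldr_cons] at h₁ ⊢
    rw [h₁, hM.update_update k l (Ne.symm hl.1)]

theorem updateList_lookup_of_notMem (hM : IsLProcModel M) {L : List V} {l : V} (hl : l ∉ L)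
    (t : Store V) (x : ℕ → A) :
    updateList M.update L t (M.lookup l x) =
      M.lookup l fun n => updateList M.update L t (x n) := by
  induction L with
  | nil => rfl
  | cons k L ih =>
    rw [List.mem_cons, not_or] at hl
    have h₁ := ih hl.2
    simp only [updateList, List.foldr_cons] at h₁ ⊢
    rw [h₁, hM.update_lookup k l (Ne.symm hl.1)]

/-- Outer operations run first, so the inner assignment prevails. As `L` has no repetitions, it
commutes past the entries after `l` and then absorbs the assignment to `l`. -/
theorem updateList_update (hM : IsLProcModel M) {L : List V} (hL : L.Nodup) {l : V} (hl : l ∈ L)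
    (n : ℕ) (t : Store V) (x : A) :
    updateList M.update L t (M.update l n x) =
      updateList M.update L (Function.update t l n) x := by
  induction L with
  | nil => cases hl
  | cons k L ih =>
    rw [List.nodup_cons] at hL
    by_cases hk : l = k
    · subst hk
      change M.update l (t l) (updateList M.update L t (M.update l n x)) =
        M.update l _ (updateList M.update L _ x)
      rw [hM.updateList_update_of_notMem hL.1, hM.update_update_self, Function.update_self,
        updateList_congr (t' := Function.update t l n)]
      intro k hk
      rw [Function.update_of_ne]
      rintro rfl
      exact hL.1 hk
    · have h₁ := ih hL.2 ((List.mem_cons.1 hl).resolve_left hk)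
      change M.update k (t k) (updateList M.update L t (M.update l n x)) =
        M.update k _ (updateList M.update L _ x)
      rw [h₁, Function.update_of_ne (Ne.symm hk)]

theorem updateList_lookup (hM : IsLProcModel M) {L : List V} (hL : L.Nodup) {l : V} (hl : l ∈ L)
    (t : Store V) (x : ℕ → A) :
    updateList M.update L t (M.lookup l x) = updateList M.update L t (x (t l)) := by
  induction L with
  | nil => cases hl
  | cons k L ih =>
    rw [List.nodup_cons] at hL
    by_cases hk : l = k
    · subst hk
      change M.update l (t l) (updateList M.update L t (M.lookup l x)) =
        M.update l _ (updateList M.update L _ _)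
      rw [hM.updateList_lookup_of_notMem hL.1, hM.update_lookup_self]
    · exact congrArg (M.update k (t k)) (ih hL.2 ((List.mem_cons.1 hl).resolve_left hk))

theorem monotone_lookup (hM : IsLProcModel M) (l : V) {x y : ℕ → A} (h : ∀ n, x n ≤ y n) :
    M.lookup l x ≤ M.lookup l y :=
  (hM.continuous_lookup l).monotone h

/-- Looking up `k` and assigning the value found changes nothing, so each side can be rewritten as a
lookup of assigned values. Lookup is monotone, which removes one variable from the list at a time.
-/
theorem le_of_updateList_le (hM : IsLProcModel M) {L : List V} (hL : L.Nodup) {x y : A}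
    (h : ∀ t, updateList M.update L t x ≤ updateList M.update L t y) : x ≤ y := by
  induction L with
  | nil => exact h fun _ => 0
  | cons k L ih =>
    rw [List.nodup_cons] at hL
    refine ih hL.2 fun t => ?_
    rw [← hM.lookup_update_self k (updateList M.update L t x),
      ← hM.lookup_update_self k (updateList M.update L t y)]
    refine hM.monotone_lookup k fun n => ?_
    -- As `k` is not in the rest of the list, overriding `t` at `k` leaves the other assignments
    -- unchanged.
    have h₁ : ∀ l ∈ L, t l = Function.update t k n l := by
      intro l hl
      rw [Function.update_of_ne]
      rintro rfl
      exact hL.1 hl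
    have h₂ := h (Function.update t k n)
    change M.update k _ (updateList M.update L _ x) ≤
      M.update k _ (updateList M.update L _ y) at h₂
    rwa [Function.update_self, ← updateList_congr h₁, ← updateList_congr h₁] at h₂

theorem updateList_omega (hM : IsLProcModel M) (L : List V) (t : Store V) :
    updateList M.update L t M.omega = M.omega := by
  induction L with
  | nil => rfl
  | cons k L ih => exact (congrArg _ ih).trans (hM.update_omega _ _)

/-- The hypothesis `ht` is the invariant of the induction: each variable either is still to be
assigned by `L'` or already has its final value. -/
theorem updateList_updateList (hM : IsLProcModel M) {L L' : List V} (hL : L.Nodup)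
    (hLL : ∀ l ∈ L', l ∈ L) {t t' : Store V} (ht : ∀ l, l ∈ L' ∨ t l = t' l) (x : A) :
    updateList M.update L t (updateList M.update L' t' x) = updateList M.update L t' x := by
  induction L' generalizing t with
  | nil =>
    have : t = t' := funext fun l => (ht l).resolve_left (by simp)
    rw [this]; rfl
  | cons k L' ih =>
    change updateList M.update L t (M.update k (t' k) (updateList M.update L' t' x)) = _
    rw [hM.updateList_update hL (hLL k List.mem_cons_self)]
    refine ih (fun l hl => hLL l (List.mem_cons_of_mem _ hl)) fun l => ?_
    by_cases hk : l = k
    · subst hk; simp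
    · simpa [hk] using ht l

theorem updateList_testList (hM : IsLProcModel M) {L L' : List V} (hL : L.Nodup)
    (hLL : ∀ l ∈ L', l ∈ L) (t s : Store V) (x : A) :
    updateList M.update L t (testList M.lookup M.omega L' s x) =
      if ∀ l ∈ L', t l = s l then updateList M.update L t x else M.omega := by
  induction L' with
  | nil => simp [testList]
  | cons k L' ih =>
    change updateList M.update L t (M.lookup k fun n =>
      if n = s k then testList M.lookup M.omega L' s x else M.omega) = _
    rw [hM.updateList_lookup hL (hLL k List.mem_cons_self)]
    by_cases hk : t k = s k
    · simp [hk, ih fun l hl => hLL l (List.mem_cons_of_mem _ hl)]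
    · simp [hk, hM.updateList_omega]

end IsLProcModel

namespace LProcStr

/-- Assign `t l` to every variable `l`. -/
noncomputable def setStore [Finite V] (M : LProcStr V A) (t : Store V) (x : A) : A :=
  updateList M.update (allVars V) t x

/-- The transition from the store `s` to the store `t`, followed by `x`. -/
noncomputable def trans [Finite V] (M : LProcStr V A) (s t : Store V) (x : A) : A :=
  transition M.update M.lookup M.omega s t x

end LProcStr

namespace IsLProcModel

variable [Finite V] [DecidableEq V] [OmegaCompletePartialOrder A] {M : LProcStr V A}

theorem setStore_update (hM : IsLProcModel M) (l : V) (n : ℕ) (t : Store V) (x : A) :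
    M.setStore t (M.update l n x) = M.setStore (Function.update t l n) x :=
  hM.updateList_update nodup_allVars (mem_allVars l) n t x

theorem setStore_lookup (hM : IsLProcModel M) (l : V) (t : Store V) (x : ℕ → A) :
    M.setStore t (M.lookup l x) = M.setStore t (x (t l)) :=
  hM.updateList_lookup nodup_allVars (mem_allVars l) t x

theorem setStore_omega (hM : IsLProcModel M) (t : Store V) : M.setStore t M.omega = M.omega :=
  hM.updateList_omega _ t

/-- Once the store is fixed, all tests are decided, and if they succeed the assignments overwrite
the whole store. So a transition acts like a matrix unit. -/
theorem setStore_trans (hM : IsLProcModel M) (s t t' : Store V) (x : A)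
    [Decidable (t = s)] :
    M.setStore t (M.trans s t' x) = if t = s then M.setStore t' x else M.omega := by
  have h : (∀ l ∈ allVars V, t l = s l) ↔ t = s :=
    ⟨fun h => funext fun l => h l (mem_allVars l), fun h l _ => congrFun h l⟩
  refine (hM.updateList_testList nodup_allVars (fun l hl => hl) t s _).trans ?_
  simp only [h]
  refine if_congr Iff.rfl ?_ rfl
  exact hM.updateList_updateList nodup_allVars (fun l hl => hl) (fun l => .inl (mem_allVars l)) x

theorem le_of_setStore_le (hM : IsLProcModel M) {x y : A}
    (h : ∀ t, M.setStore t x ≤ M.setStore t y) : x ≤ y :=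
  hM.le_of_updateList_le nodup_allVars h

theorem ext_setStore (hM : IsLProcModel M) {x y : A}
    (h : ∀ t, M.setStore t x = M.setStore t y) : x = y :=
  le_antisymm (hM.le_of_setStore_le fun t => (h t).le) (hM.le_of_setStore_le fun t => (h t).ge)

theorem preserves_setStore (hM : IsLProcModel M) (t : Store V) :
    PreservesCountableSups (M.setStore t) := by
  suffices h : ∀ L : List V, PreservesCountableSups (updateList M.update L t) from h _
  intro L
  induction L with
  | nil => 
    intro S _ _ x hx
    change IsLUB ((fun x => x) '' S) x
    rwa [Set.image_id']
  | cons k L ih => exact (hM.preserves_update k (t k)).comp ih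

theorem monotone_trans (hM : IsLProcModel M) (s t : Store V) : Monotone (M.trans s t) := by
  classical
  intro x y h
  refine hM.le_of_setStore_le fun t' => ?_
  rw [hM.setStore_trans, hM.setStore_trans]
  split_ifs
  · exact (hM.preserves_setStore t).monotone h
  · exact le_rfl

end IsLProcModel

theorem IsLProcHom.map_trans [Finite V] [OmegaCompletePartialOrder A]
    [OmegaCompletePartialOrder B] {M : LProcStr V A} {N : LProcStr V B} {h : A → B}
    (hh : IsLProcHom M N h) (s t : Store V) (x : A) : h (M.trans s t x) = N.trans s t (h x) :=
  map_transition hh.map_update hh.map_lookup hh.map_omega s t x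

end CoopThreads

namespace CoopThreads

/-! ## Principal ideals -/

section

variable {V A : Type*}

@[simp] theorem PSeq.le_nil_iff {u : PSeq V} : u ≤ .nil ↔ u = .nil :=
  ⟨fun h => by cases h; rfl, by rintro rfl; exact le_rfl⟩

@[simp] theorem PSeq.step_le_step_iff {s t s' t' : Store V} {u u' : PSeq V} :
    PSeq.step s t u ≤ .step s' t' u' ↔ s = s' ∧ t = t' ∧ u ≤ u' :=
  ⟨fun h => by cases h with | step _ _ h => exact ⟨rfl, rfl, h⟩,
    by rintro ⟨rfl, rfl, h⟩; exact .step _ _ h⟩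

theorem PSeq.le_done_iff {u : PSeq V} : u ≤ .done ↔ u = .nil ∨ u = .done := by
  constructor
  · rintro (_ | _) <;> simp
  · rintro (rfl | rfl)
    · exact .nil _
    · exact le_rfl

@[simp] theorem PSeq.done_le_iff {u : PSeq V} : PSeq.done ≤ u ↔ u = .done :=
  ⟨fun h => by cases h; rfl, by rintro rfl; exact le_rfl⟩

@[simp] theorem TSeq.le_nil_iff {u : TSeq V} : u ≤ .nil ↔ u = .nil :=
  ⟨fun h => by cases h; rfl, by rintro rfl; exact le_rfl⟩

@[simp] theorem TSeq.step_le_step_iff {s t s' t' : Store V} {u u' : TSeq V} :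
    TSeq.step s t u ≤ .step s' t' u' ↔ s = s' ∧ t = t' ∧ u ≤ u' :=
  ⟨fun h => by cases h with | step _ _ h => exact ⟨rfl, rfl, h⟩,
    by rintro ⟨rfl, rfl, h⟩; exact .step _ _ h⟩

@[simp] theorem TSeq.ret_le_ret_iff {s t s' t' : Store V} {u u' : PSeq V} :
    TSeq.ret s t u ≤ .ret s' t' u' ↔ s = s' ∧ t = t' ∧ u ≤ u' :=
  ⟨fun h => by cases h with | ret _ _ h => exact ⟨rfl, rfl, h⟩,
    by rintro ⟨rfl, rfl, h⟩; exact .ret _ _ h⟩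

@[simp] theorem TSeq.not_step_le_ret {s t s' t' : Store V} {u : TSeq V} {u' : PSeq V} :
    ¬ TSeq.step s t u ≤ .ret s' t' u' := nofun

@[simp] theorem TSeq.not_ret_le_step {s t s' t' : Store V} {u : PSeq V} {u' : TSeq V} :
    ¬ TSeq.ret s t u ≤ .step s' t' u' := nofun

theorem PShuf.le_of_le_done {u v w : PSeq V} (h : PShuf u v w) (hv : v ≤ .done) : w ≤ u := by
  rcases PSeq.le_done_iff.1 hv with rfl | rfl
  · exact h.comm.le_of_nil
  · exact (PShuf.done_right_iff.1 h).le

/-- Besides the empty sequence, transition sequences are images under `theta`. Countability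
ultimately comes from having finitely many variables. -/
instance TSeq.instCountable [Finite V] : Countable (TSeq V) := by
  let f : Option (QTrans V RetPoint) → TSeq V := fun x => x.elim .nil theta
  have hf : Function.Surjective f := by
    intro u
    by_cases hu : u = .nil
    · exact ⟨none, hu.symm⟩
    · obtain ⟨v, rfl⟩ := exists_theta_eq hu
      exact ⟨some v, rfl⟩
  exact hf.countable

/-- The set of all prefixes of `u`. -/
def Proc.below (u : TSeq V) : Proc V where
  carrier := {v | v ≤ u}
  nonempty := ⟨u, le_refl u⟩
  prefixClosed _ _ h h' := h.trans h'

/-- The set of all proper prefixes of `u`. -/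
def AProc.below (u : PSeq V) : AProc V where
  carrier := {w | w ≤ u ∧ w ≠ .done}
  nonempty := ⟨.nil, .nil u, nofun⟩
  prefixClosed := by
    rintro v w h ⟨h', hw⟩
    refine ⟨h.trans h', ?_⟩
    rintro rfl
    exact hw (PSeq.done_le_iff.1 h)
  proper h := h.2 rfl

@[simp] theorem Proc.mem_below {u v : TSeq V} : u ∈ (below v).carrier ↔ u ≤ v := Iff.rfl

@[simp] theorem AProc.mem_below {u v : PSeq V} : u ∈ (below v).carrier ↔ u ≤ v ∧ u ≠ .done :=
  Iff.rfl

theorem Proc.below_le_iff {u : TSeq V} {P : Proc V} : below u ≤ P ↔ u ∈ P.carrier :=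
  ⟨fun h => h (le_refl u), fun h _ hv => P.prefixClosed hv h⟩

theorem AProc.below_le_iff {u : PSeq V} {P : AProc V} (hu : u ≠ .done) :
    below u ≤ P ↔ u ∈ P.carrier :=
  ⟨fun h => h ⟨le_refl u, hu⟩, fun h _ hv => P.prefixClosed hv.1 h⟩

theorem AProc.below_mono : Monotone (below (V := V)) := fun _ _ h _ hw => ⟨hw.1.trans h, hw.2⟩

theorem Proc.isLUB_below (P : Proc V) : IsLUB (below '' P.carrier) P := by
  constructor
  · rintro _ ⟨u, hu, rfl⟩
    exact below_le_iff.2 hu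
  · exact fun b hb u hu => below_le_iff.1 (hb ⟨u, hu, rfl⟩)

theorem AProc.isLUB_below (P : AProc V) : IsLUB (below '' P.carrier) P := by
  constructor
  · rintro _ ⟨u, hu, rfl⟩
    exact (below_le_iff (P.ne_done hu)).2 hu
  · exact fun b hb u hu => (below_le_iff (P.ne_done hu)).1 (hb ⟨u, hu, rfl⟩)

/-- A process is the union of countably many principal ideals, so maps that preserve countable sups
are determined there. -/
theorem Proc.funext_below [Finite V] [PartialOrder A] {F G : Proc V → A}
    (hF : PreservesCountableSups F) (hG : PreservesCountableSups G)
    (h : ∀ u, F (below u) = G (below u)) (P : Proc V) : F P = G P := by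
  have hc := (Set.to_countable P.carrier).image below
  have h₁ := hF hc (P.nonempty.image _) P.isLUB_below
  have h₂ := hG hc (P.nonempty.image _) P.isLUB_below
  rw [Set.image_image] at h₁ h₂
  simp only [h] at h₁
  exact h₁.unique h₂

theorem AProc.funext_below [Finite V] [PartialOrder A] {F G : AProc V → A}
    (hF : PreservesCountableSups F) (hG : PreservesCountableSups G)
    (h : ∀ u, u ≠ .done → F (below u) = G (below u)) (P : AProc V) : F P = G P := by
  have hc := (Set.to_countable P.carrier).image below
  have h₁ := hF hc (P.nonempty.image _) P.isLUB_below
  have h₂ := hG hc (P.nonempty.image _) P.isLUB_below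
  rw [Set.image_image] at h₁ h₂
  rw [Set.image_congr fun u hu => h u (P.ne_done hu)] at h₁
  exact h₁.unique h₂

/-- The union of a non-empty set of processes is again a process, hence an upper bound that contains
the sup. -/
theorem Proc.exists_mem_of_isLUB {S : Set (Proc V)} (hS : S.Nonempty) {P : Proc V}
    (hP : IsLUB S P) {u : TSeq V} (hu : u ∈ P.carrier) : ∃ Q ∈ S, u ∈ Q.carrier := by
  let U : Proc V :=
    { carrier := ⋃ Q ∈ S, Q.carrier
      nonempty := by
        obtain ⟨Q, hQ⟩ := hS
        exact ⟨.nil, Set.mem_biUnion hQ Q.nil_mem⟩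
      prefixClosed := by
        intro u v h hv
        simp only [Set.mem_iUnion] at hv ⊢
        obtain ⟨Q, hQ, hv⟩ := hv
        exact ⟨Q, hQ, Q.prefixClosed h hv⟩ }
  have hPU : P ≤ U := hP.2 fun Q hQ => Set.subset_biUnion_of_mem (u := Proc.carrier) hQ
  simpa [U] using hPU hu

/-! ## Principal ideals by the operations -/

/-- Here `p s x` is to be read as a property of `x` run from the store `s`. Its abstract form serves
plain and return transitions of processes and transitions of asynchronous processes alike. -/
theorem iff_transition [Finite V] [DecidableEq V] {upd : V → ℕ → A → A}
    {lk : V → (ℕ → A) → A} {om : A} {p : Store V → A → Prop}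
    (hu : ∀ s l n x, p s (upd l n x) ↔ p (Function.update s l n) x)
    (hl : ∀ s l x, p s (lk l x) ↔ p s (x (s l))) (ho : ∀ s, ¬ p s om) (s s' t : Store V) (x : A) :
    p s (transition upd lk om s' t x) ↔ s = s' ∧ p t x := by
  have h₁ : ∀ (L : List V) (s : Store V) (x : A),
      p s (testList lk om L s' x) ↔ (∀ l ∈ L, s l = s' l) ∧ p s x := by
    intro L s x
    induction L with
    | nil => simp [testList]
    | cons k L ih =>
      refine (hl _ _ _).trans ?_
      by_cases hk : s k = s' k
      · rw [if_pos hk]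
        refine ih.trans ?_
        simp [hk]
      · simp [hk, ho]
  -- The induction needs stores that may already agree with `t` outside `L`.
  have h₂ : ∀ (L : List V) (s : Store V) (x : A), (∀ l, l ∈ L ∨ s l = t l) →
      (p s (updateList upd L t x) ↔ p t x) := by
    intro L
    induction L with
    | nil =>
      intro s x h
      have : s = t := funext fun l => (h l).resolve_left (by simp)
      rw [this]; rfl
    | cons k L ih =>
      intro s x h
      refine (hu _ _ _ _).trans (ih _ _ fun l => ?_)
      by_cases hk : l = k
      · subst hk; simp
      · simpa [hk] using h l
  rw [transition, h₁, h₂ _ _ _ fun l => .inl (mem_allVars l)]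
  exact and_congr_left fun _ => ⟨fun h => funext fun l => h l (mem_allVars l), fun h _ _ => h ▸ rfl⟩

@[simp] theorem Proc.step_notMem_skip {s t : Store V} {u : TSeq V} :
    TSeq.step s t u ∉ (Proc.skip : Proc V).carrier := by
  rintro ⟨_, h⟩
  cases h

@[simp] theorem Proc.ret_mem_skip {s t : Store V} {u : PSeq V} :
    TSeq.ret s t u ∈ (Proc.skip : Proc V).carrier ↔ t = s ∧ u ≤ .done := by
  constructor
  · rintro ⟨_, h⟩
    cases h with | ret _ _ h => exact ⟨rfl, h⟩
  · rintro ⟨rfl, h⟩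
    exact ⟨_, .ret _ _ h⟩

/-- After its return `skip` offers only prefixes of `Done`. Shuffling with `Done` reproduces all of
`P`, and the empty prefix adds nothing new. -/
theorem Proc.ret_mem_async_skip {P : AProc V} {s t : Store V} {u : PSeq V} :
    TSeq.ret s t u ∈ (Proc.async P Proc.skip).carrier ↔ t = s ∧ u ∈ P.carrier := by
  simp only [Proc.ret_mem_async, Proc.ret_mem_skip]
  constructor
  · rintro ⟨v, hv, v₂, ⟨rfl, hv₂⟩, h⟩
    exact ⟨rfl, P.prefixClosed (h.le_of_le_done hv₂) hv⟩
  · rintro ⟨rfl, hu⟩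
    exact ⟨u, hu, .done, ⟨rfl, le_rfl⟩, PShuf.done_right_iff.2 rfl⟩

theorem Proc.below_nil [DecidableEq V] : below (.nil : TSeq V) = (str V).omega :=
  Proc.ext (Set.ext fun _ => TSeq.le_nil_iff)

theorem AProc.below_nil : below (.nil : PSeq V) = omega := by
  apply ext_steps
  simp

variable [Finite V] [DecidableEq V]

theorem Proc.step_mem_trans {s s' t t' : Store V} {u : TSeq V} {P : Proc V} :
    TSeq.step s t' u ∈ ((str V).trans s' t P).carrier ↔ s = s' ∧ TSeq.step t t' u ∈ P.carrier :=
  iff_transition (p := fun s P => TSeq.step s t' u ∈ Proc.carrier P) (fun _ _ _ _ => Iff.rfl)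
    (fun _ _ _ => step_mem_lookup) (fun _ h => by simpa using mem_omega.1 h) s s' t P

theorem Proc.ret_mem_trans {s s' t t' : Store V} {u : PSeq V} {P : Proc V} :
    TSeq.ret s t' u ∈ ((str V).trans s' t P).carrier ↔ s = s' ∧ TSeq.ret t t' u ∈ P.carrier :=
  iff_transition (p := fun s P => TSeq.ret s t' u ∈ Proc.carrier P) (fun _ _ _ _ => Iff.rfl)
    (fun _ _ _ => ret_mem_lookup) (fun _ h => by simpa using mem_omega.1 h) s s' t P

/-- The transition from `s` to `t`, followed by `P`, for asynchronous processes. -/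
noncomputable def AProc.trans (s t : Store V) (P : AProc V) : AProc V :=
  transition update lookup omega s t P

theorem AProc.step_mem_trans {s s' t t' : Store V} {u : PSeq V} {P : AProc V} :
    PSeq.step s t' u ∈ (trans s' t P).carrier ↔ s = s' ∧ PSeq.step t t' u ∈ P.carrier :=
  iff_transition (p := fun s P => PSeq.step s t' u ∈ AProc.carrier P)
    (fun _ _ _ _ => step_mem_update) (fun _ _ _ => step_mem_lookup)
    (fun _ h => by simpa using mem_omega.1 h) s s' t P

theorem IsLProcModel.trans_yieldTo [OmegaCompletePartialOrder A] {M : LProcStr V A}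
    (hM : IsLProcModel M) (s t : Store V) (P : AProc V) (x : A) :
    M.yieldTo (P.trans s t) x = M.trans s t (M.yieldTo P x) :=
  map_transition (h := fun P => M.yieldTo P x) (fun l n P => hM.update_yieldTo P l n x)
    (fun l P => hM.lookup_yieldTo P l x) (hM.omega_yieldTo x) s t P

theorem IsLProcModel.async_trans [OmegaCompletePartialOrder A] {M : LProcStr V A}
    (hM : IsLProcModel M) (P : AProc V) (s t : Store V) (x : A) :
    M.async P (M.trans s t x) = M.trans s t (M.async P x) :=
  map_transition (hM.async_update P) (hM.async_lookup P) (hM.async_omega P) s t x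

namespace Proc

theorem below_step (s t : Store V) (u : TSeq V) :
    below (.step s t u) = (str V).trans s t ((str V).d (below u)) := by
  apply ext_steps <;> intro s' t' u'
  · rw [step_mem_trans]
    exact TSeq.step_le_step_iff.trans
      (and_congr_right fun _ => (step_mem_d (Q := below u)).symm)
  · rw [ret_mem_trans]
    exact iff_of_false (by simp) fun h => ret_notMem_d h.2

theorem below_ret_done (s t : Store V) : below (.ret s t .done) = (str V).trans s t skip := by
  apply ext_steps <;> intro s' t' u'
  · rw [step_mem_trans]
    exact iff_of_false (by simp) fun h => step_notMem_skip h.2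
  · rw [ret_mem_trans]
    exact TSeq.ret_le_ret_iff.trans (and_congr_right fun _ => ret_mem_skip.symm)

/-- What follows the return is the sequence of a spawned thread. The case of `Done` alone is
excluded because no asynchronous process contains it; that case is `skip` without a spawned thread.
-/
theorem below_ret (s t : Store V) {u : PSeq V} (hu : u ≠ .done) :
    below (.ret s t u) = (str V).trans s t ((str V).async (.below u) skip) := by
  apply ext_steps <;> intro s' t' u'
  · rw [step_mem_trans]
    refine iff_of_false (by simp) fun h => ?_
    obtain ⟨v, hv, v₂, hv₂, h⟩ := step_mem_async.1 h.2
    exact step_notMem_skip hv₂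
  · rw [ret_mem_trans]
    refine TSeq.ret_le_ret_iff.trans (and_congr_right fun _ => ?_)
    refine Iff.trans (and_congr_right fun _ => ?_) ret_mem_async_skip.symm
    refine (and_iff_left_of_imp ?_).symm
    rintro h rfl
    exact hu (PSeq.done_le_iff.1 h)

end Proc

namespace AProc

theorem below_step_done (s t : Store V) : below (.step s t .done) = trans s t halt := by
  apply ext_steps
  intro s' t' u'
  rw [step_mem_trans, step_mem_halt]
  simp

theorem below_step (s t : Store V) {u : PSeq V} (hu : u ≠ .done) :
    below (.step s t u) = trans s t (d (below u)) := by
  apply ext_steps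
  intro s' t' u'
  rw [step_mem_trans, step_mem_d]
  simp only [mem_below, PSeq.step_le_step_iff, ne_eq, reduceCtorEq, not_false_eq_true, and_true]
  refine and_congr_right fun _ => and_congr_right fun _ => (and_iff_left_of_imp ?_).symm
  rintro h rfl
  exact hu (PSeq.done_le_iff.1 h)

end AProc

end

/-! ## The extension of a point of a model to a morphism -/

/-- The value of `u` after a return with continuation `a`. -/
def LProcStr.afterReturn {V A : Type*} (N : LProcStr V A) (a : A) : PSeq V → A
  | .done => a
  | u => N.async (.below u) a

theorem LProcStr.afterReturn_of_ne {V A : Type*} (N : LProcStr V A) (a : A) {u : PSeq V}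
    (hu : u ≠ .done) :
    N.afterReturn a u = N.async (.below u) a := by
  cases u with
  | done => exact absurd rfl hu
  | _ => rfl

/-- The critical comparison is that of the empty sequence with `Done`. It is exactly the inequation
of the theory, which enters the freeness argument here. -/
theorem IsLProcModel.afterReturn_mono {V A : Type*} [DecidableEq V]
    [OmegaCompletePartialOrder A] {N : LProcStr V A} {a : A} (hN : IsLProcModel N) :
    Monotone (N.afterReturn a) := by
  intro u v h
  by_cases hv : v = .done
  · subst hv
    rcases PSeq.le_done_iff.1 h with rfl | rfl
    · change N.async (.below .nil) a ≤ a
      rw [AProc.below_nil]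
      exact hN.omega_async_le a
    · exact le_rfl
  · have hu : u ≠ .done := by
      rintro rfl
      exact hv (PSeq.done_le_iff.1 h)
    rw [N.afterReturn_of_ne a hu, N.afterReturn_of_ne a hv]
    exact (hN.preserves_async_left a).monotone (AProc.below_mono h)

variable {V A : Type*} [Finite V] [DecidableEq V] [OmegaCompletePartialOrder A]
  {N : LProcStr V A} {a : A}

namespace LProcStr

/-- The value of the principal ideal of a transition sequence in a model, with `a` for `skip`. -/
noncomputable def liftSeq (N : LProcStr V A) (a : A) : TSeq V → A
  | .nil => N.omega
  | .step s t u => N.trans s t (N.d (liftSeq N a u))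
  | .ret s t u => N.trans s t (N.afterReturn a u)

end LProcStr

namespace IsLProcModel

theorem liftSeq_mono (hN : IsLProcModel N) : Monotone (N.liftSeq a) := by
  intro u v h
  induction h with
  | nil => exact hN.omega_le _
  | step s t h ih => exact hN.monotone_trans s t (hN.preserves_d.monotone ih)
  | ret s t h => exact hN.monotone_trans s t (hN.afterReturn_mono h)

/-- The morphism from processes to a model that sends `skip` to `a`. -/
noncomputable def lift (hN : IsLProcModel N) (a : A) (P : Proc V) : A :=
  (hN.exists_isLUB ((Set.to_countable P.carrier).image (N.liftSeq a))
    (P.nonempty.image _)).choose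

theorem isLUB_lift (hN : IsLProcModel N) (a : A) (P : Proc V) :
    IsLUB (N.liftSeq a '' P.carrier) (hN.lift a P) :=
  (hN.exists_isLUB ((Set.to_countable P.carrier).image (N.liftSeq a))
    (P.nonempty.image _)).choose_spec

theorem lift_below (hN : IsLProcModel N) (u : TSeq V) :
    hN.lift a (.below u) = N.liftSeq a u := by
  refine (hN.isLUB_lift a _).unique ⟨?_, fun b hb => hb ⟨u, le_refl u, rfl⟩⟩
  rintro _ ⟨v, hv, rfl⟩
  exact hN.liftSeq_mono hv

/-- An element of a sup of processes lies in one of them, so both sides are sups of the same values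
of `liftSeq`. -/
theorem preserves_lift (hN : IsLProcModel N) : PreservesCountableSups (hN.lift a) := by
  intro S hS hne P hP
  constructor
  · rintro _ ⟨Q, hQ, rfl⟩
    refine (hN.isLUB_lift a Q).2 ?_
    rintro _ ⟨u, hu, rfl⟩
    exact (hN.isLUB_lift a P).1 ⟨u, hP.1 hQ hu, rfl⟩
  · intro b hb
    refine (hN.isLUB_lift a P).2 ?_
    rintro _ ⟨u, hu, rfl⟩
    obtain ⟨Q, hQ, hu⟩ := Proc.exists_mem_of_isLUB hne hP hu
    exact ((hN.isLUB_lift a Q).1 ⟨u, hu, rfl⟩).trans (hb ⟨Q, hQ, rfl⟩)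

-- The extension computed from a fixed initial store

theorem isLUB_setStore_lift (hN : IsLProcModel N) (t : Store V) (P : Proc V) :
    IsLUB ((fun u => N.setStore t (N.liftSeq a u)) '' P.carrier) (N.setStore t (hN.lift a P)) := by
  have := hN.preserves_setStore t ((Set.to_countable P.carrier).image (N.liftSeq a))
    (P.nonempty.image _) (hN.isLUB_lift a P)
  rwa [Set.image_image] at this

theorem setStore_trans_self (hN : IsLProcModel N) (s t : Store V) (x : A) :
    N.setStore s (N.trans s t x) = N.setStore t x := by
  classical
  rw [hN.setStore_trans, if_pos rfl]

theorem setStore_liftSeq_step (hN : IsLProcModel N) (s t : Store V) (u : TSeq V) :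
    N.setStore s (N.liftSeq a (.step s t u)) = N.setStore t (N.d (N.liftSeq a u)) :=
  hN.setStore_trans_self s t _

theorem setStore_liftSeq_ret (hN : IsLProcModel N) (s t : Store V) (u : PSeq V) :
    N.setStore s (N.liftSeq a (.ret s t u)) = N.setStore t (N.afterReturn a u) :=
  hN.setStore_trans_self s t _

theorem setStore_liftSeq_cases (hN : IsLProcModel N) (a : A) (s : Store V) (u : TSeq V) :
    N.setStore s (N.liftSeq a u) = N.omega ∨ (∃ t v, u = .step s t v) ∨
      ∃ t v, u = .ret s t v := by
  classical
  cases u with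
  | nil => exact .inl (hN.setStore_omega s)
  | step s' t v =>
    by_cases h : s = s'
    · subst h; exact .inr (.inl ⟨t, v, rfl⟩)
    · exact .inl ((hN.setStore_trans _ _ _ _).trans (if_neg h))
  | ret s' t v =>
    by_cases h : s = s'
    · subst h; exact .inr (.inr ⟨t, v, rfl⟩)
    · exact .inl ((hN.setStore_trans _ _ _ _).trans (if_neg h))

/-- A sequence with another initial store contributes only the least element. With the two lower
bounds below, this describes the extension at `s` through the members of `P` that start in `s`. -/
theorem setStore_lift_le (hN : IsLProcModel N) {P : Proc V} {s : Store V} {b : A}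
    (hs : ∀ t u, TSeq.step s t u ∈ P.carrier → N.setStore t (N.d (N.liftSeq a u)) ≤ b)
    (hr : ∀ t u, TSeq.ret s t u ∈ P.carrier → N.setStore t (N.afterReturn a u) ≤ b) :
    N.setStore s (hN.lift a P) ≤ b := by
  refine (hN.isLUB_setStore_lift s P).2 ?_
  rintro _ ⟨u, hu, rfl⟩
  rcases hN.setStore_liftSeq_cases a s u with h | ⟨t, v, rfl⟩ | ⟨t, v, rfl⟩
  · exact h.trans_le (hN.omega_le b)
  · exact (hN.setStore_liftSeq_step s t v).trans_le (hs t v hu)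
  · exact (hN.setStore_liftSeq_ret s t v).trans_le (hr t v hu)

theorem le_setStore_lift_of_step (hN : IsLProcModel N) {P : Proc V} {s t : Store V} {u : TSeq V}
    (h : TSeq.step s t u ∈ P.carrier) :
    N.setStore t (N.d (N.liftSeq a u)) ≤ N.setStore s (hN.lift a P) :=
  (hN.isLUB_setStore_lift s P).1 ⟨_, h, hN.setStore_liftSeq_step s t u⟩

theorem le_setStore_lift_of_ret (hN : IsLProcModel N) {P : Proc V} {s t : Store V} {u : PSeq V}
    (h : TSeq.ret s t u ∈ P.carrier) :
    N.setStore t (N.afterReturn a u) ≤ N.setStore s (hN.lift a P) :=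
  (hN.isLUB_setStore_lift s P).1 ⟨_, h, hN.setStore_liftSeq_ret s t u⟩

/-- Only the possible continuations from the initial store matter, not the store itself. This
settles the store operations, which just redirect the initial store or select a process. -/
theorem setStore_lift_eq (hN : IsLProcModel N) {P P' : Proc V} {s s' : Store V}
    (hs : ∀ t u, TSeq.step s t u ∈ P.carrier ↔ TSeq.step s' t u ∈ P'.carrier)
    (hr : ∀ t u, TSeq.ret s t u ∈ P.carrier ↔ TSeq.ret s' t u ∈ P'.carrier) :
    N.setStore s (hN.lift a P) = N.setStore s' (hN.lift a P') :=
  le_antisymm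
    (hN.setStore_lift_le (fun t u h => hN.le_setStore_lift_of_step ((hs t u).1 h))
      fun t u h => hN.le_setStore_lift_of_ret ((hr t u).1 h))
    (hN.setStore_lift_le (fun t u h => hN.le_setStore_lift_of_step ((hs t u).2 h))
      fun t u h => hN.le_setStore_lift_of_ret ((hr t u).2 h))

theorem lift_update (hN : IsLProcModel N) (l : V) (n : ℕ) (P : Proc V) :
    hN.lift a ((Proc.str V).update l n P) = N.update l n (hN.lift a P) :=
  hN.ext_setStore fun t => by
    rw [hN.setStore_update]
    exact hN.setStore_lift_eq (fun _ _ => Iff.rfl) fun _ _ => Iff.rfl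

theorem lift_lookup (hN : IsLProcModel N) (l : V) (P : ℕ → Proc V) :
    hN.lift a ((Proc.str V).lookup l P) = N.lookup l fun n => hN.lift a (P n) :=
  hN.ext_setStore fun t => by
    rw [hN.setStore_lookup]
    exact hN.setStore_lift_eq (fun _ _ => Proc.step_mem_lookup) fun _ _ => Proc.ret_mem_lookup

theorem lift_union (hN : IsLProcModel N) (P Q : Proc V) :
    hN.lift a ((Proc.str V).union P Q) = N.union (hN.lift a P) (hN.lift a Q) := by
  have := hN.preserves_lift (a := a) (S := {P, Q}) (Set.toFinite _).countable ⟨P, by simp⟩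
    (Proc.isLProcModel.isLUB_union P Q)
  rw [Set.image_pair] at this
  exact this.unique (hN.isLUB_union _ _)

theorem lift_omega (hN : IsLProcModel N) : hN.lift a (Proc.str V).omega = N.omega := by
  rw [← Proc.below_nil, hN.lift_below, LProcStr.liftSeq]

/-- From a fixed store, both sides are sups of the values of `d` at `liftSeq a u` for `u` in `P`. -/
theorem lift_d (hN : IsLProcModel N) (P : Proc V) :
    hN.lift a ((Proc.str V).d P) = N.d (hN.lift a P) :=
  hN.ext_setStore fun t => by
    have h := hN.preserves_setStore t
      ((Set.to_countable P.carrier).image (N.liftSeq a) |>.image N.d)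
      ((P.nonempty.image _).image _) (hN.preserves_d ((Set.to_countable P.carrier).image _)
        (P.nonempty.image _) (hN.isLUB_lift a P))
    apply le_antisymm
    · refine hN.setStore_lift_le (fun t' u hu => ?_) fun t' u hu => absurd hu Proc.ret_notMem_d
      obtain ⟨rfl, hu'⟩ := Proc.step_mem_d.1 hu
      exact h.1 ⟨_, ⟨_, ⟨u, hu', rfl⟩, rfl⟩, rfl⟩
    · refine h.2 ?_
      rintro _ ⟨_, ⟨_, ⟨u, hu, rfl⟩, rfl⟩, rfl⟩
      exact hN.le_setStore_lift_of_step (Proc.step_mem_d.2 ⟨rfl, hu⟩)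

/-- Among the members of `skip` with a given initial store, the one that ends in `Done` is the
largest, and its value is `a`. -/
theorem lift_skip (hN : IsLProcModel N) : hN.lift a Proc.skip = a :=
  hN.ext_setStore fun t => by
    apply le_antisymm
    · refine hN.setStore_lift_le (fun t' u hu => absurd hu Proc.step_notMem_skip)
        fun t' u hu => ?_
      obtain ⟨rfl, hu'⟩ := Proc.ret_mem_skip.1 hu
      exact (hN.preserves_setStore t').monotone (hN.afterReturn_mono (a := a) hu')
    · exact hN.le_setStore_lift_of_ret (u := .done) (Proc.ret_mem_skip.2 ⟨rfl, le_rfl⟩)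

theorem lift_async_skip (hN : IsLProcModel N) (P : AProc V) :
    hN.lift a ((Proc.str V).async P Proc.skip) = N.async P a :=
  hN.ext_setStore fun t => by
    have hc := (Set.to_countable P.carrier).image AProc.below
    have h := hN.preserves_setStore t (hc.image _) ((P.nonempty.image _).image _)
      (hN.preserves_async_left a hc (P.nonempty.image _) P.isLUB_below)
    apply le_antisymm
    · refine hN.setStore_lift_le (fun t' u hu => ?_) fun t' u hu => ?_
      · obtain ⟨_, _, _, hv, _⟩ := Proc.step_mem_async.1 hu
        exact absurd hv Proc.step_notMem_skip
      · obtain ⟨rfl, hu'⟩ := Proc.ret_mem_async_skip.1 hu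
        rw [N.afterReturn_of_ne a (P.ne_done hu')]
        exact h.1 ⟨_, ⟨_, ⟨u, hu', rfl⟩, rfl⟩, rfl⟩
    · refine h.2 ?_
      rintro _ ⟨_, ⟨_, ⟨u, hu, rfl⟩, rfl⟩, rfl⟩
      change N.setStore t (N.async (.below u) a) ≤ _
      rw [← N.afterReturn_of_ne a (P.ne_done hu)]
      exact hN.le_setStore_lift_of_ret (Proc.ret_mem_async_skip.2 ⟨rfl, hu⟩)

theorem lift_trans (hN : IsLProcModel N) (s t : Store V) (P : Proc V) :
    hN.lift a ((Proc.str V).trans s t P) = N.trans s t (hN.lift a P) :=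
  map_transition hN.lift_update hN.lift_lookup hN.lift_omega s t P

/-- Induction on a principal asynchronous process: unfolding `yieldTo` on `d` produces an action,
whose `async` part concerns the same `x`. Hence the hypothesis for this `x` and all `P`. -/
theorem lift_yieldTo_of_async (hN : IsLProcModel N) {x : Proc V}
    (hx : ∀ P, hN.lift a ((Proc.str V).async P x) = N.async P (hN.lift a x)) (P : AProc V) :
    hN.lift a ((Proc.str V).yieldTo P x) = N.yieldTo P (hN.lift a x) := by
  have hM := Proc.isLProcModel (V := V)
  refine AProc.funext_below (F := fun P => hN.lift a ((Proc.str V).yieldTo P x))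
    (hN.preserves_lift.comp (hM.preserves_yieldTo_left x)) (hN.preserves_yieldTo_left _)
    (fun u hu => ?_) P
  induction u with
  | nil => simp only [AProc.below_nil, hM.omega_yieldTo, hN.omega_yieldTo, hN.lift_omega]
  | done => exact absurd rfl hu
  | step s t u ih =>
    by_cases hd : u = .done
    · subst hd
      simp only [AProc.below_step_done, hM.trans_yieldTo, hN.trans_yieldTo, hN.lift_trans,
        hM.halt_yieldTo, hN.halt_yieldTo, hN.lift_d]
    · simp only [AProc.below_step s t hd, hM.trans_yieldTo, hN.trans_yieldTo, hN.lift_trans,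
        hM.d_yieldTo, hN.d_yieldTo, hN.lift_d, LProcStr.act, hN.lift_union, hx, ih hd]

/-- Induction on a principal process with `P` arbitrary: unfolding `async` on `d` produces an action
on the shorter sequence, whose `yieldTo` part needs the induction hypothesis for every `P`. At a
return, nested `async` collapses to a single one applied to `skip`. -/
theorem lift_async (hN : IsLProcModel N) (P : AProc V) (x : Proc V) :
    hN.lift a ((Proc.str V).async P x) = N.async P (hN.lift a x) := by
  have hM := Proc.isLProcModel (V := V)
  refine Proc.funext_below (F := fun x => hN.lift a ((Proc.str V).async P x))
    (hN.preserves_lift.comp (hM.preserves_async P)) ((hN.preserves_async P).comp hN.preserves_lift)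
    (fun u => ?_) x
  induction u generalizing P with
  | nil => simp only [Proc.below_nil, hM.async_omega, hN.async_omega, hN.lift_omega]
  | step s t u ih =>
    simp only [Proc.below_step, hM.async_trans, hN.async_trans, hN.lift_trans, hM.async_d,
      hN.async_d, hN.lift_d, LProcStr.act, hN.lift_union, ih, hN.lift_yieldTo_of_async ih]
  | ret s t u =>
    by_cases hd : u = .done
    · subst hd
      simp only [Proc.below_ret_done, hM.async_trans, hN.async_trans, hN.lift_trans,
        hN.lift_async_skip, hN.lift_skip]
    · simp only [Proc.below_ret s t hd, hM.async_trans, hN.async_trans, hN.lift_trans,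
        hM.async_async, hN.async_async, hN.lift_async_skip]

theorem isLProcHom_lift (hN : IsLProcModel N) (a : A) :
    IsLProcHom (Proc.str V) N (hN.lift a) where
  continuous := hN.preserves_lift.ωScottContinuous
  map_update := hN.lift_update
  map_lookup := hN.lift_lookup
  map_union := hN.lift_union
  map_omega := hN.lift_omega
  map_d := hN.lift_d
  map_async := hN.lift_async
  map_yieldTo P x := hN.lift_yieldTo_of_async (fun P => hN.lift_async P x) P

theorem eq_lift (hN : IsLProcModel N) {h : Proc V → A} (hh : IsLProcHom (Proc.str V) N h)
    (ha : h Proc.skip = a) : h = hN.lift a := by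
  have hl := hN.isLProcHom_lift a
  funext P
  refine Proc.funext_below (Proc.isLProcModel.preserves hN hh.continuous hh.map_union)
    hN.preserves_lift (fun u => ?_) P
  induction u with
  | nil => rw [Proc.below_nil, hh.map_omega, hl.map_omega]
  | step s t u ih => rw [Proc.below_step, hh.map_trans, hl.map_trans, hh.map_d, hl.map_d, ih]
  | ret s t u =>
    by_cases hd : u = .done
    · rw [hd, Proc.below_ret_done, hh.map_trans, hl.map_trans, ha, hN.lift_skip]
    · rw [Proc.below_ret s t hd, hh.map_trans, hl.map_trans, hh.map_async, hl.map_async, ha,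
        hN.lift_skip]

end IsLProcModel

/-! ## The Kleisli extension -/

/-- Membership in a composite involves just one member of the left factor. -/
theorem Proc.preserves_comp {V : Type*} (R : Proc V) :
    PreservesCountableSups fun P : Proc V => P.comp R := by
  intro S _ hne P hP
  constructor
  · rintro _ ⟨Q, hQ, rfl⟩ r hr
    have hQP : Q.carrier ⊆ P.carrier := hP.1 hQ
    rcases hr with ⟨l, s, t, t₂, w, w₂, v, h₁, h⟩ | ⟨l, s, t, t₂, w, w₂, v, h₁, h⟩ | ⟨h₁, h⟩
    · exact .inl ⟨l, s, t, t₂, w, w₂, v, hQP h₁, h⟩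
    · exact .inr (.inl ⟨l, s, t, t₂, w, w₂, v, hQP h₁, h⟩)
    · exact .inr (.inr ⟨hQP h₁, h⟩)
  · intro b hb r hr
    rcases hr with ⟨l, s, t, t₂, w, w₂, v, h₁, h⟩ | ⟨l, s, t, t₂, w, w₂, v, h₁, h⟩ | ⟨h₁, h⟩
    · obtain ⟨Q, hQ, h₁⟩ := exists_mem_of_isLUB hne hP h₁
      exact hb ⟨Q, hQ, rfl⟩ (.inl ⟨l, s, t, t₂, w, w₂, v, h₁, h⟩)
    · obtain ⟨Q, hQ, h₁⟩ := exists_mem_of_isLUB hne hP h₁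
      exact hb ⟨Q, hQ, rfl⟩ (.inr (.inl ⟨l, s, t, t₂, w, w₂, v, h₁, h⟩))
    · obtain ⟨Q, hQ, h₁⟩ := exists_mem_of_isLUB hne hP h₁
      exact hb ⟨Q, hQ, rfl⟩ (.inr (.inr ⟨h₁, h⟩))

@[simp] theorem TSeq.append_cons {V : Type*} (p : Store V × Store V)
    (l : List (Store V × Store V)) (v : TSeq V) :
    TSeq.append (p :: l) v = .step p.1 p.2 (TSeq.append l v) := rfl

/-- Transitions before the return are carried along unchanged, so composition can be computed by
recursion on the left sequence. -/
theorem Proc.mem_comp_below_step {V : Type*} {R : Proc V} {s t : Store V} {u r : TSeq V} :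
    r ∈ ((below (.step s t u)).comp R).carrier ↔
      r = .nil ∨ ∃ r₂ ∈ ((below u).comp R).carrier, r = .step s t r₂ := by
  constructor
  · rintro (⟨l, s₁, t₁, t₂, w, w₂, v, h₁, h₂, h₃, rfl⟩ |
      ⟨l, s₁, t₁, t₂, w, w₂, v, h₁, h₂, h₃, rfl⟩ | ⟨h₁, l, rfl⟩) <;>
    rcases l with _ | ⟨p, l⟩
    · exact absurd h₁ TSeq.not_ret_le_step
    · obtain ⟨h, h', h₄⟩ := TSeq.step_le_step_iff.1 h₁
      refine .inr ⟨_, .inl ⟨l, s₁, t₁, t₂, w, w₂, v, h₄, h₂, h₃, rfl⟩, ?_⟩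
      rw [TSeq.append_cons, h, h']
    · exact absurd h₁ TSeq.not_ret_le_step
    · obtain ⟨h, h', h₄⟩ := TSeq.step_le_step_iff.1 h₁
      refine .inr ⟨_, .inr (.inl ⟨l, s₁, t₁, t₂, w, w₂, v, h₄, h₂, h₃, rfl⟩), ?_⟩
      rw [TSeq.append_cons, h, h']
    · exact .inl rfl
    · obtain ⟨h, h', h₄⟩ := TSeq.step_le_step_iff.1 h₁
      refine .inr ⟨TSeq.append l .nil, .inr (.inr ⟨h₄, l, rfl⟩), ?_⟩
      rw [TSeq.append_cons, h, h']
  · rintro (rfl | ⟨_, ⟨l, s₁, t₁, t₂, w, w₂, v, h₁, h₂, h₃, rfl⟩ |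
      ⟨l, s₁, t₁, t₂, w, w₂, v, h₁, h₂, h₃, rfl⟩ | ⟨h₁, l, rfl⟩, rfl⟩)
    · exact nil_mem _
    · exact .inl ⟨(s, t) :: l, s₁, t₁, t₂, w, w₂, v, TSeq.Pfx.step s t h₁, h₂, h₃, rfl⟩
    · exact .inr (.inl ⟨(s, t) :: l, s₁, t₁, t₂, w, w₂, v, TSeq.Pfx.step s t h₁, h₂, h₃, rfl⟩)
    · exact .inr (.inr ⟨TSeq.Pfx.step s t h₁, (s, t) :: l, rfl⟩)

theorem Proc.mem_comp_below_ret {V : Type*} {R : Proc V} {s t : Store V} {u : PSeq V}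
    {r : TSeq V} :
    r ∈ ((below (.ret s t u)).comp R).carrier ↔ r = .nil ∨
      (∃ t₂ w w₂ v, w ≤ u ∧ TSeq.step t t₂ w₂ ∈ R.carrier ∧ TShuf w w₂ v ∧ r = .step s t₂ v) ∨
      ∃ t₂ w w₂ v, w ≤ u ∧ TSeq.ret t t₂ w₂ ∈ R.carrier ∧ PShuf w w₂ v ∧ r = .ret s t₂ v := by
  constructor
  · rintro (⟨l, s₁, t₁, t₂, w, w₂, v, h₁, h₂, h₃, rfl⟩ |
      ⟨l, s₁, t₁, t₂, w, w₂, v, h₁, h₂, h₃, rfl⟩ | ⟨h₁, l, rfl⟩) <;>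
    rcases l with _ | ⟨p, l⟩
    · obtain ⟨rfl, rfl, h₄⟩ := TSeq.ret_le_ret_iff.1 h₁
      exact .inr (.inl ⟨t₂, w, w₂, v, h₄, h₂, h₃, rfl⟩)
    · exact absurd h₁ TSeq.not_step_le_ret
    · obtain ⟨rfl, rfl, h₄⟩ := TSeq.ret_le_ret_iff.1 h₁
      exact .inr (.inr ⟨t₂, w, w₂, v, h₄, h₂, h₃, rfl⟩)
    · exact absurd h₁ TSeq.not_step_le_ret
    · exact .inl rfl
    · exact absurd h₁ TSeq.not_step_le_ret
  · rintro (rfl | ⟨t₂, w, w₂, v, h₁, h₂, h₃, rfl⟩ | ⟨t₂, w, w₂, v, h₁, h₂, h₃, rfl⟩)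
    · exact nil_mem _
    · exact .inl ⟨[], s, t, t₂, w, w₂, v, TSeq.Pfx.ret s t h₁, h₂, h₃, rfl⟩
    · exact .inr (.inl ⟨[], s, t, t₂, w, w₂, v, TSeq.Pfx.ret s t h₁, h₂, h₃, rfl⟩)

theorem Proc.comp_below_nil {V : Type*} (R : Proc V) : (below .nil).comp R = omega := by
  apply ext_steps <;> intro s t u <;> refine iff_of_false ?_ nofun <;>
  · rintro (⟨_ | _, _, _, _, _, _, _, h, _⟩ | ⟨_ | _, _, _, _, _, _, _, h, _⟩ | ⟨h, _⟩) <;> cases h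

theorem TShuf.mem_of_le_done {V : Type*} {R : Proc V} {s t : Store V} {w : PSeq V} {w₂ v : TSeq V}
    (h : TShuf w w₂ v) (hw : w ≤ .done) (h₂ : TSeq.step s t w₂ ∈ R.carrier) :
    TSeq.step s t v ∈ R.carrier := by
  rcases PSeq.le_done_iff.1 hw with rfl | rfl
  · exact R.prefixClosed (.step s t h.le_of_nil) h₂
  · rwa [TShuf.done_left_iff.1 h]

/-- Both sides obey the same recursion: plain transitions are kept, and at the return the remainder
of `u` is shuffled into `R`, as in `async`. -/
theorem Proc.liftSeq_eq_comp (R : Proc V) (u : TSeq V) :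
    (str V).liftSeq R u = (below u).comp R := by
  induction u with
  | nil => exact (comp_below_nil R).symm
  | step s t u ih =>
    rw [LProcStr.liftSeq, ih]
    apply ext_steps <;> intro s' t' r <;> rw [mem_comp_below_step]
    · rw [step_mem_trans]
      refine (and_congr_right fun _ => step_mem_d).trans ?_
      simp only [reduceCtorEq, TSeq.step.injEq, false_or]
      grind
    · rw [ret_mem_trans]
      exact iff_of_false (fun h => ret_notMem_d h.2) (by simp)
  | ret s t u =>
    rw [LProcStr.liftSeq]
    by_cases hd : u = .done
    · subst hd
      -- With remainder `Done` the value is `R` itself. The shuffles on the other side involve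
      -- `Done`, which is neutral, or its empty prefix, whose results lie in `R` by prefix closure.
      rw [LProcStr.afterReturn]
      apply ext_steps <;> intro s' t' r <;> rw [mem_comp_below_ret]
      · rw [step_mem_trans]
        constructor
        · rintro ⟨rfl, h⟩
          exact .inr (.inl ⟨_, .done, _, _, le_rfl, h, TShuf.done_left_iff.2 rfl, rfl⟩)
        · rintro (⟨⟨⟩⟩ | ⟨t₂, w, w₂, v, h₁, h₂, h₃, ⟨⟩⟩ | ⟨t₂, w, w₂, v, h₁, h₂, h₃, ⟨⟩⟩)
          exact ⟨rfl, h₃.mem_of_le_done h₁ h₂⟩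
      · rw [ret_mem_trans]
        constructor
        · rintro ⟨rfl, h⟩
          exact .inr (.inr ⟨_, .done, _, _, le_rfl, h, PShuf.done_left_iff.2 rfl, rfl⟩)
        · rintro (⟨⟨⟩⟩ | ⟨t₂, w, w₂, v, h₁, h₂, h₃, ⟨⟩⟩ | ⟨t₂, w, w₂, v, h₁, h₂, h₃, ⟨⟩⟩)
          exact ⟨rfl, R.prefixClosed (.ret _ _ (h₃.comm.le_of_le_done h₁)) h₂⟩
    · have hw : ∀ {w}, w ≤ u → w ≠ .done := by
        rintro _ h rfl
        exact hd (PSeq.done_le_iff.1 h)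
      rw [LProcStr.afterReturn_of_ne _ _ hd]
      apply ext_steps <;> intro s' t' r <;> rw [mem_comp_below_ret]
      · rw [step_mem_trans]
        refine (and_congr_right fun _ => step_mem_async).trans ?_
        constructor
        · rintro ⟨rfl, v, hv, v₂, hv₂, h⟩
          exact .inr (.inl ⟨_, v, v₂, _, hv.1, hv₂, h, rfl⟩)
        · rintro (⟨⟨⟩⟩ | ⟨t₂, w, w₂, v, h₁, h₂, h₃, ⟨⟩⟩ | ⟨t₂, w, w₂, v, h₁, h₂, h₃, ⟨⟩⟩)
          exact ⟨rfl, w, ⟨h₁, hw h₁⟩, w₂, h₂, h₃⟩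
      · rw [ret_mem_trans]
        refine (and_congr_right fun _ => ret_mem_async).trans ?_
        constructor
        · rintro ⟨rfl, v, hv, v₂, hv₂, h⟩
          exact .inr (.inr ⟨_, v, v₂, _, hv.1, hv₂, h, rfl⟩)
        · rintro (⟨⟨⟩⟩ | ⟨t₂, w, w₂, v, h₁, h₂, h₃, ⟨⟩⟩ | ⟨t₂, w, w₂, v, h₁, h₂, h₃, ⟨⟩⟩)
          exact ⟨rfl, w, ⟨h₁, hw h₁⟩, w₂, h₂, h₃⟩

theorem Proc.lift_eq_comp (R : Proc V) :
    Proc.isLProcModel.lift R = fun P : Proc V => P.comp R := by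
  funext P
  exact funext_below Proc.isLProcModel.preserves_lift (preserves_comp R)
    (fun u => (Proc.isLProcModel.lift_below u).trans (liftSeq_eq_comp R u)) P

end CoopThreads

-- The free model and its Kleisli extension

theorem corollary6p5 {V : Type v} [Finite V] [DecidableEq V] :
    -- both structures are models, and `thetaTilde` is an isomorphism between them
    IsLProcModel (Iomega.str V RetPoint) ∧
    IsLProcModel (Proc.str V) ∧
    IsLProcIso (Iomega.str V RetPoint)
      (Proc.str V) thetaTilde ∧
    -- the processes are the free model over `{Ret}`, with unit `Ret ↦ skip`
    IsFreeLProcModel.{w} (Proc.str V)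
      (fun _ : RetPoint => Proc.skip) ∧
    -- the Kleisli extension of `f`, i.e. its unique extension to a morphism
    ∀ (f : RetPoint → Proc V)
      (h : Proc V → Proc V),
      (IsLProcHom (Proc.str V) (Proc.str V) h ∧
          ∀ x : RetPoint, h Proc.skip = f x) ↔
        h = fun P => P.comp (f RetPoint.Ret) := by
  have hM := Proc.isLProcModel (V := V)
  refine ⟨hM.of_orderIso isLProcHom_thetaTilde, hM, isLProcIso_thetaTilde,
    ⟨hM, .const, fun B _ N hN f _ => ⟨hN.lift (f .Ret), ⟨hN.isLProcHom_lift _, fun _ =>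
      hN.lift_skip⟩, fun h hh => hN.eq_lift hh.1 (hh.2 .Ret)⟩⟩, fun f h => ?_⟩
  rw [← Proc.lift_eq_comp]
  constructor
  · exact fun hh => hM.eq_lift hh.1 (hh.2 .Ret)
  · rintro rfl
    exact ⟨hM.isLProcHom_lift _, fun _ => hM.lift_skip⟩
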